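/- Let $M$ be a smooth three-dimensional manifold with a smooth complex-valued metric $g_{ab}$, i.e. a smooth field of nondegenerate symmetric complex bilinear forms on $T^{\mathbb C}M=\mathbb C\otimes TM$ (for instance the complex-bilinear extension of a pseudo-Riemannian metric of any signature), with Levi-Civita connection $\nabla$. Conventions: $R_{abd}{}^{c}V^{d}=2\nabla_{[a}\nabla_{b]}V^{c}$, $R_{ab}=R_{acb}{}^{c}$, $R=g^{ab}R_{ab}$, $S=\tfrac1{12}R$, $\Phi_{ab}=R_{ab}-\tfrac13Rg_{ab}$; the Cotton tensor is $A_{abc}=2\nabla_{[b}P_{c]a}$ with $P_{ab}=-\Phi_{ab}-\tfrac1{12}Rg_{ab}$; square brackets denote skew-symmetrisation with weight one. A null structure is a smooth complex line subbundle $N\subset T^{\mathbb C}M$ of null vectors. It is co-geodetic if $g(\nabla_XY,Z)=0$ for all local sections $X,Y$ of $N^{\perp}$ and $Z$ of $N$. At a point take a frame $(k^a,\ell^a,n^a)$ with $k^a$ spanning $N$ and $g_{ab}=2k_{(a}\ell_{b)}-2n_an_b$. The null lines at the point are spanned by $\xi(z)=k+2zn+z^2\ell$ with $z\in\mathbb C$,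 together with $\ell$ (for $z=\infty$), and the principal null lines are the roots in $\mathbb{CP}^1$ of the quartic $\Phi(z)=\tfrac12\Phi_{ab}\xi^a(z)\xi^b(z)$. $N$ is multiple principal if, at every point, $z=0$ is a root of multiplicity at least two (i.e. $z^2$ divides $\Phi(z)$). The Petrov type of $\Phi_{ab}$ at a point is given by the multiplicities of the roots: I $\{1,1,1,1\}$, II $\{2,1,1\}$, III $\{3,1\}$, N $\{4\}$, D $\{2,2\}$, and O if $\Phi_{ab}=0$. Let $N$ be a null structure that is co-geodetic and multiple principal, and let $k^a$ be any generator of $N$. 1. If at every point $\Phi_{ab}$ is of Petrov type II or degenerates further (types II, D, III, N, O), then $$k^ak^b\left(A_{abc}+3g_{bc}\nabla_aS\right)=0.$$ 2. If at every point $\Phi_{ab}$ is of Petrov type III or degenerates further (types III, N, O), then $$k^a\left(A_{abc}-2g_{a[b}\nabla_{c]}S\right)=0,\qquad k^ak^bA_{abc}=0,\qquad k^a\nabla_aS=0.$$ 3. If at every point $\Phi_{ab}$ is of Petrov type N or degenerates further (types N, O), then $$k^c\left(A_{abc}-g_{ca}\nabla_bS\right)=0,\qquad k^aA_{abc}=0,\qquad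 k_{[a}\nabla_{b]}S=0.$$ -/

import Mathlib

open scoped Manifold ContDiff TensorProduct

namespace NullGeom

/-! ### Tensor calculus of a complex-valued metric in local coordinates

`g : R3 → Matrix (Fin 3) (Fin 3) ℂ` is the matrix of components `g_{ab}` as a function of the
(real) coordinates. -/

/-- Coordinate space. -/
abbrev R3 : Type := EuclideanSpace ℝ (Fin 3)

/-- The partial derivative `∂_i f`. -/
noncomputable def pd (i : Fin 3) (f : R3 → ℂ) (x : R3) : ℂ :=
  fderiv ℝ f x (EuclideanSpace.single i (1 : ℝ))

section Coordinates

variable (g : R3 → Matrix (Fin 3) (Fin 3) ℂ) (x : R3)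

/-- Christoffel symbol `Γ^c_{ab}` of the Levi-Civita connection. -/
noncomputable def christoffel (c a b : Fin 3) : ℂ :=
  (1 / 2) * ∑ d, (g x)⁻¹ c d *
    (pd a (fun y => g y b d) x + pd b (fun y => g y a d) x - pd d (fun y => g y a b) x)

/-- `(∇_X Y)^c` for vector fields with components `X^a`, `Y^a`. -/
noncomputable def covDerivVec (X Y : R3 → Fin 3 → ℂ) (c : Fin 3) : ℂ :=
  ∑ a, X x a * (pd a (fun y => Y y c) x + ∑ b, christoffel g x c a b * Y x b)

/-- `∇_a T_{bc}`. -/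
noncomputable def covDerivTwo (T : R3 → Matrix (Fin 3) (Fin 3) ℂ) (a b c : Fin 3) : ℂ :=
  pd a (fun y => T y b c) x - ∑ d, christoffel g x d a b * T x d c
    - ∑ d, christoffel g x d a c * T x b d

/-- The Riemann tensor `R_{abd}^c`, with `R_{abd}^c V^d = (∇_a ∇_b - ∇_b ∇_a) V^c`. -/
noncomputable def riemann (a b d c : Fin 3) : ℂ :=
  pd a (fun y => christoffel g y c b d) x - pd b (fun y => christoffel g y c a d) x
    + ∑ e, (christoffel g x c a e * christoffel g x e b d
        - christoffel g x c b e * christoffel g x e a d)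

/-- The Ricci tensor `R_{ab} = R_{acb}^c`. -/
noncomputable def ricci (a b : Fin 3) : ℂ := ∑ c, riemann g x a c b c

/-- The Ricci scalar `R = g^{ab} R_{ab}`. -/
noncomputable def ricciScalar : ℂ := ∑ a, ∑ b, (g x)⁻¹ a b * ricci g x a b

/-- `S = R / 12`. -/
noncomputable def scalS : ℂ := (1 / 12) * ricciScalar g x

/-- The tracefree Ricci tensor `Φ_{ab} = R_{ab} - (1/3) R g_{ab}`. -/
noncomputable def tracefreeRicci : Matrix (Fin 3) (Fin 3) ℂ :=
  Matrix.of fun a b => ricci g x a b - (1 / 3) * ricciScalar g x * g x a b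

/-- The Schouten tensor `P_{ab} = - Φ_{ab} - (1/12) R g_{ab}`. -/
noncomputable def schouten : Matrix (Fin 3) (Fin 3) ℂ :=
  Matrix.of fun a b => - tracefreeRicci g x a b - (1 / 12) * ricciScalar g x * g x a b

/-- The Cotton tensor `A_{abc} = 2 ∇_{[b} P_{c]a} = ∇_b P_{ca} - ∇_c P_{ba}`. -/
noncomputable def cotton (a b c : Fin 3) : ℂ :=
  covDerivTwo g x (schouten g) b c a - covDerivTwo g x (schouten g) c b a

/-- `∇_a S`. -/
noncomputable def gradS (a : Fin 3) : ℂ := pd a (scalS g) x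

end Coordinates

/-! ### Algebra at a point: null frames, the quartic of `Φ`, Petrov types

Here `G` is the matrix of the metric and `P` that of the tracefree Ricci tensor at a point. -/

section Pointwise

variable (G P : Matrix (Fin 3) (Fin 3) ℂ)

/-- Lowering an index: `v_a = g_{ab} v^b`. -/
def lower (v : Fin 3 → ℂ) (a : Fin 3) : ℂ := ∑ b, G a b * v b

/-- `(k, ℓ, n)` is a null frame adapted to the line spanned by `k`:
`g_{ab} = 2 k_{(a} ℓ_{b)} - 2 n_a n_b`. For a nondegenerate metric this makes it a frame with
`k`, `ℓ` null and orthogonal to `n`, `k_a ℓ^a = 1` and `n_a n^a = -1/2`. -/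
def IsAdaptedFrame (k l n : Fin 3 → ℂ) : Prop :=
  ∀ a b, G a b = lower G k a * lower G l b + lower G l a * lower G k b
    - 2 * (lower G n a * lower G n b)

/-- The components of the null vector `ξ(z) = k + 2 z n + z² ℓ`, as polynomials in `z`.
As `z` runs through `ℂ` these are, up to scale, all null vectors other than `ℓ` (`z = ∞`). -/
noncomputable def nullVec (k l n : Fin 3 → ℂ) (a : Fin 3) : Polynomial ℂ :=
  Polynomial.C (k a) + Polynomial.C (2 * n a) * Polynomial.X
    + Polynomial.C (l a) * Polynomial.X ^ 2

/-- The quartic `Φ(z) = (1/2) Φ_{ab} ξ^a(z) ξ^b(z)`. -/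
noncomputable def ricciQuartic (k l n : Fin 3 → ℂ) : Polynomial ℂ :=
  Polynomial.C (1 / 2) *
    ∑ a, ∑ b, Polynomial.C (P a b) * nullVec k l n a * nullVec k l n b

/-- The null line spanned by `k` is a root of the quartic of multiplicity at least `m`: in a frame
adapted to it, in which it is the root `z = 0`, the quartic is divisible by `z ^ m`. -/
def RootMultGE (m : ℕ) (k : Fin 3 → ℂ) : Prop :=
  ∃ l n, IsAdaptedFrame G k l n ∧ Polynomial.X ^ m ∣ ricciQuartic P k l n

/-- The null line spanned by `k` is a root of the quartic of multiplicity exactly `m`. -/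
def RootMultEq (m : ℕ) (k : Fin 3 → ℂ) : Prop :=
  RootMultGE G P m k ∧ ¬ RootMultGE G P (m + 1) k

/-- The Petrov types. -/
inductive PetrovType
  | typeI | typeII | typeIII | typeN | typeD | typeO

/-- The Petrov type of `Φ` is read off from the multiplicities (with sum `4`) of the roots of its
quartic in `ℂP¹`, that is, of its principal null lines:
I = `{1,1,1,1}`, II = `{2,1,1}`, III = `{3,1}`, N = `{4}`, D = `{2,2}`, and O means `Φ = 0`. -/
def HasPetrovType : PetrovType → Prop
  | .typeI => P ≠ 0 ∧ ∀ k, ¬ RootMultGE G P 2 k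
  | .typeII => ∃ k, RootMultEq G P 2 k ∧
      ∀ k', RootMultGE G P 2 k' → k' ∈ Submodule.span ℂ {k}
  | .typeIII => ∃ k, RootMultEq G P 3 k
  | .typeN => ∃ k, RootMultEq G P 4 k
  | .typeD => ∃ k k', k' ∉ Submodule.span ℂ {k} ∧ RootMultEq G P 2 k ∧ RootMultEq G P 2 k'
  | .typeO => P = 0

end Pointwise

/-! ### Complex-valued metrics and null structures on a three-dimensional manifold -/

section Manifold

variable (M : Type*) [TopologicalSpace M] [ChartedSpace R3 M]

variable {M} in
/-- The complexified tangent space `ℂ ⊗ T_p M`. -/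
abbrev TC (p : M) : Type := ℂ ⊗[ℝ] TangentSpace (𝓡 3) p

variable {M} in
/-- The complex tangent vector `∑ v^i ∂_i` at the point with coordinates `x` in the chart `e`. -/
noncomputable def vec (e : OpenPartialHomeomorph M R3) (x : R3) (v : Fin 3 → ℂ) :
    TC (e.symm x) :=
  ∑ i, v i ⊗ₜ[ℝ] (mfderiv (𝓡 3) (𝓡 3) e.symm x (EuclideanSpace.single i (1 : ℝ)))

variable {M} in
/-- The component matrix `g_{ij} = g(∂_i, ∂_j)` in the chart `e` of a field of bilinear forms. -/
noncomputable def comps (b : ∀ p : M, LinearMap.BilinForm ℂ (TC p))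
    (e : OpenPartialHomeomorph M R3) (x : R3) : Matrix (Fin 3) (Fin 3) ℂ :=
  Matrix.of fun i j => b (e.symm x) (vec e x (Pi.single i 1)) (vec e x (Pi.single j 1))

/-- A smooth complex-valued metric on `M`: a smooth field of nondegenerate symmetric complex
bilinear forms on the complexified tangent spaces, with no reality condition. The complex bilinear
extension of a (pseudo-)Riemannian metric of any signature is an example. -/
structure ComplexMetric where
  form : ∀ p : M, LinearMap.BilinForm ℂ (TC p)
  symm : ∀ p (v w : TC p), form p v w = form p w v
  nondegenerate : ∀ p (v : TC p), (∀ w, form p v w = 0) → v = 0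
  smooth : ∀ e ∈ IsManifold.maximalAtlas (𝓡 3) ∞ M, ∀ i j,
    ContDiffOn ℝ ∞ (fun x => comps form e x i j) e.target

variable {M}

/-- A null structure: a smooth complex line subbundle of `ℂ ⊗ T M` consisting of null vectors.
Smoothness: locally, in any chart, it is spanned by a smooth vector field. -/
structure NullStructure (g : ComplexMetric M) where
  line : ∀ p : M, Submodule ℂ (TC p)
  finrank_line : ∀ p, Module.finrank ℂ (line p) = 1
  null : ∀ p, ∀ v ∈ line p, g.form p v v = 0
  smooth : ∀ e ∈ IsManifold.maximalAtlas (𝓡 3) ∞ M, ∀ x ∈ e.target,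
    ∃ V : Set R3, IsOpen V ∧ x ∈ V ∧ V ⊆ e.target ∧ ∃ k : R3 → Fin 3 → ℂ,
      ContDiffOn ℝ ∞ k V ∧ ∀ y ∈ V, line (e.symm y) = Submodule.span ℂ {vec e y (k y)}

variable {g : ComplexMetric M}

/-- Membership of `v` in the orthogonal complement `N^⊥` at `p`. -/
def NullStructure.InPerp (N : NullStructure g) (p : M) (v : TC p) : Prop :=
  ∀ k ∈ N.line p, g.form p v k = 0

/-- `N` is co-geodetic: `g(∇_X Y, Z) = 0` for all (local, smooth) sections `X`, `Y` of `N^⊥` and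
`Z` of `N`. -/
def NullStructure.IsCoGeodetic (N : NullStructure g) : Prop :=
  ∀ e ∈ IsManifold.maximalAtlas (𝓡 3) ∞ M, ∀ V : Set R3, IsOpen V → V ⊆ e.target →
    ∀ X Y Z : R3 → Fin 3 → ℂ, ContDiffOn ℝ ∞ X V → ContDiffOn ℝ ∞ Y V → ContDiffOn ℝ ∞ Z V →
      (∀ y ∈ V, N.InPerp (e.symm y) (vec e y (X y))) →
      (∀ y ∈ V, N.InPerp (e.symm y) (vec e y (Y y))) →
      (∀ y ∈ V, vec e y (Z y) ∈ N.line (e.symm y)) →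
      ∀ y ∈ V, ∑ c, ∑ d, comps g.form e y c d
        * covDerivVec (comps g.form e) y X Y c * Z y d = 0

/-- `N` is multiple principal (at every point): it is a root of multiplicity at least two of the
quartic of the tracefree Ricci tensor. -/
def NullStructure.IsMultiplePrincipal (N : NullStructure g) : Prop :=
  ∀ e ∈ IsManifold.maximalAtlas (𝓡 3) ∞ M, ∀ x ∈ e.target,
    ∃ k : Fin 3 → ℂ, vec e x k ∈ N.line (e.symm x) ∧
      RootMultGE (comps g.form e x) (tracefreeRicci (comps g.form e) x) 2 k

/-- The tracefree Ricci tensor of `g` has Petrov type `T` at `p`. -/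
def ComplexMetric.HasPetrovTypeAt (g : ComplexMetric M) (p : M) (T : PetrovType) : Prop :=
  ∀ e ∈ IsManifold.maximalAtlas (𝓡 3) ∞ M, p ∈ e.source →
    HasPetrovType (comps g.form e (e p)) (tracefreeRicci (comps g.form e) (e p)) T

end Manifold

end NullGeom

namespace NullGeom

/-! ### Partial derivatives -/

section Calculus

variable {f h : R3 → ℂ} {x : R3}

/-! Locally, lower a generator of N to a covector K, normalise it by K_i = 1 for some index i, and
put k = g⁻¹K. Co-geodesy makes the annihilator of K totally geodesic, that is ∇_aK_b = K_a u_b + v_a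
K_b, and nullity of K forces k·u = 0 (`exists_covDerivCov_eq`). A root of multiplicity two is an
eigenvector, Φ_{ab}k^b = μK_a (`RootMultGE.exists_eigen`). When this equation is differentiated the
v-terms cancel, leaving (∇_cΦ_{ab})k^b = ∂_cμ K_a + K_c w_a with w = μu − Φu and k·w = 0
(`exists_covDerivTwo_tracefreeRicci`).

The other ingredient is the contracted Bianchi identity ∇^aΦ_{ae} = 2∇_eS (`div_tracefreeRicci`).
Contracted with k^e it gives k·∂μ = 2 k·∇S (`pd_eigenvalue`). Substituting in A_{abc} = ∇_cΦ_{ba} −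
∇_bΦ_{ca} + g_{ba}∇_cS − g_{ca}∇_bS gives k^ak^bA_{abc} = −3K_c k·∇S, which is the first claim.

A Petrov type asserts the existence of some degenerate null line, not that this line is N. The link
is a frame-free property of the endomorphism Φ: its cube vanishes for types III, N, O, and its
square for N, O. Combined with a double root at N, a vanishing cube gives μ = 0 and Φ(N^⊥) ⊆ span K,
so w is a multiple of K and (∇_cΦ_{ab})k^b is symmetric in c, a; it then drops out of k^aA_{abc}. A
vanishing square gives Φ_{ab} = φK_aK_b, and Bianchi then makes ∇S a multiple sK of K with
k^c∇_cΦ_{ab} = 2sK_aK_b (`exists_gradS_of_square`), from which the third group of claims follows. -/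

theorem contDiffAt_pd (hf : ContDiffAt ℝ ∞ f x) (i : Fin 3) : ContDiffAt ℝ ∞ (pd i f) x :=
  (hf.fderiv_right (m := ∞) (by simp)).clm_apply contDiffAt_const

theorem differentiableAt_of_contDiffAt (hf : ContDiffAt ℝ ∞ f x) : DifferentiableAt ℝ f x :=
  hf.differentiableAt (by simp)

theorem pd_congr (i : Fin 3) (hfh : f =ᶠ[nhds x] h) : pd i f x = pd i h x := by
  simp only [pd, hfh.fderiv_eq]

theorem pd_const (i : Fin 3) (c : ℂ) : pd i (fun _ => c) x = 0 := by
  simp [pd]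

theorem pd_add (i : Fin 3) (hf : ContDiffAt ℝ ∞ f x) (hh : ContDiffAt ℝ ∞ h x) :
    pd i (fun y => f y + h y) x = pd i f x + pd i h x := by
  simp only [pd]
  rw [fderiv_fun_add (differentiableAt_of_contDiffAt hf)
    (differentiableAt_of_contDiffAt hh)]
  rfl

theorem pd_sub (i : Fin 3) (hf : ContDiffAt ℝ ∞ f x) (hh : ContDiffAt ℝ ∞ h x) :
    pd i (fun y => f y - h y) x = pd i f x - pd i h x := by
  simp only [pd]
  rw [fderiv_fun_sub (differentiableAt_of_contDiffAt hf)
    (differentiableAt_of_contDiffAt hh)]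
  rfl

theorem pd_mul (i : Fin 3) (hf : ContDiffAt ℝ ∞ f x) (hh : ContDiffAt ℝ ∞ h x) :
    pd i (fun y => f y * h y) x = pd i f x * h x + f x * pd i h x := by
  simp only [pd]
  rw [fderiv_fun_mul (differentiableAt_of_contDiffAt hf)
    (differentiableAt_of_contDiffAt hh)]
  simp
  ring

theorem pd_sum {ι : Type*} (i : Fin 3) (s : Finset ι) {F : ι → R3 → ℂ}
    (hF : ∀ j ∈ s, ContDiffAt ℝ ∞ (F j) x) :
    pd i (fun y => ∑ j ∈ s, F j y) x = ∑ j ∈ s, pd i (F j) x := by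
  simp only [pd]
  rw [fderiv_fun_sum fun j hj => differentiableAt_of_contDiffAt (hF j hj)]
  simp

theorem pd_comm (i j : Fin 3) (hf : ContDiffAt ℝ ∞ f x) :
    pd i (pd j f) x = pd j (pd i f) x := by
  have hd : DifferentiableAt ℝ (fderiv ℝ f) x :=
    (hf.fderiv_right (m := ∞) (by simp)).differentiableAt (by simp)
  have key (a b : Fin 3) : pd a (pd b f) x =
      fderiv ℝ (fderiv ℝ f) x (EuclideanSpace.single a 1) (EuclideanSpace.single b 1) := by
    have : fderiv ℝ (fun y => fderiv ℝ f y (EuclideanSpace.single b (1 : ℝ))) x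
        = (fderiv ℝ (fderiv ℝ f) x).flip (EuclideanSpace.single b 1) := by
      rw [fderiv_clm_apply hd (differentiableAt_const _)]
      simp
    change fderiv ℝ (fun y => fderiv ℝ f y (EuclideanSpace.single b (1 : ℝ))) x _ = _
    rw [this]
    rfl
  rw [key, key]
  exact (hf.isSymmSndFDerivAt (by simp; exact ENat.LEInfty.out)) _ _

end Calculus

/-! ### Matrix-valued functions -/

section MatrixCalculus

/-- Smoothness at a point of a matrix-valued function. -/
def MatSmoothAt {m n : Type*} (F : R3 → Matrix m n ℂ) (x : R3) : Prop :=
  ∀ i j, ContDiffAt ℝ ∞ (fun y => F y i j) x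

/-- The entrywise partial derivative of a matrix-valued function. -/
noncomputable def pdMat {m n : Type*} (c : Fin 3) (F : R3 → Matrix m n ℂ) (x : R3) :
    Matrix m n ℂ :=
  Matrix.of fun i j => pd c (fun y => F y i j) x

variable {l m n : Type*} {x : R3} {F F' : R3 → Matrix l m ℂ} {H : R3 → Matrix m n ℂ}

theorem MatSmoothAt.mul [Fintype m] (hF : MatSmoothAt F x) (hH : MatSmoothAt H x) :
    MatSmoothAt (fun y => F y * H y) x := fun i j => by
  simp only [Matrix.mul_apply]
  exact ContDiffAt.sum fun k _ => (hF i k).mul (hH k j)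

theorem MatSmoothAt.sub (hF : MatSmoothAt F x) (hH : MatSmoothAt F' x) :
    MatSmoothAt (fun y => F y - F' y) x := fun i j => (hF i j).sub (hH i j)

theorem MatSmoothAt.transpose (hF : MatSmoothAt F x) :
    MatSmoothAt (fun y => (F y).transpose) x := fun i j => hF j i

theorem MatSmoothAt.pdMat (hF : MatSmoothAt F x) (c : Fin 3) :
    MatSmoothAt (NullGeom.pdMat c F) x := fun i j => contDiffAt_pd (hF i j) c

theorem pdMat_congr (c : Fin 3) (h : F =ᶠ[nhds x] F') : pdMat c F x = pdMat c F' x := by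
  ext i j
  exact pd_congr c (h.mono fun y hy => by simp only [hy])

theorem pdMat_const (c : Fin 3) (A : Matrix l m ℂ) : pdMat c (fun _ => A) x = 0 := by
  ext i j
  exact pd_const c _

theorem pdMat_add (c : Fin 3) (hF : MatSmoothAt F x) (hF' : MatSmoothAt F' x) :
    pdMat c (fun y => F y + F' y) x = pdMat c F x + pdMat c F' x := by
  ext i j
  exact pd_add c (hF i j) (hF' i j)

theorem pdMat_sub (c : Fin 3) (hF : MatSmoothAt F x) (hF' : MatSmoothAt F' x) :
    pdMat c (fun y => F y - F' y) x = pdMat c F x - pdMat c F' x := by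
  ext i j
  exact pd_sub c (hF i j) (hF' i j)

theorem pdMat_mul [Fintype m] (c : Fin 3) (hF : MatSmoothAt F x) (hH : MatSmoothAt H x) :
    pdMat c (fun y => F y * H y) x = pdMat c F x * H x + F x * pdMat c H x := by
  ext i j
  simp only [pdMat, Matrix.mul_apply, Matrix.of_apply, Matrix.add_apply]
  rw [pd_sum c _ fun k _ => (hF i k).mul (hH k j), ← Finset.sum_add_distrib]
  exact Finset.sum_congr rfl fun k _ => pd_mul c (hF i k) (hH k j)

theorem pdMat_transpose (c : Fin 3) :
    pdMat c (fun y => (F y).transpose) x = (pdMat c F x).transpose := rfl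

theorem pdMat_comm (a b : Fin 3) (hF : MatSmoothAt F x) :
    pdMat a (pdMat b F) x = pdMat b (pdMat a F) x := by
  ext i j
  exact pd_comm a b (hF i j)

end MatrixCalculus

end NullGeom

namespace NullGeom

/-! ### The Levi-Civita connection in matrix form -/

open Matrix

/-- A smooth nondegenerate symmetric matrix of metric components on an open set. -/
structure IsLocalMetric (g : R3 → Matrix (Fin 3) (Fin 3) ℂ) (V : Set R3) : Prop where
  isOpen : IsOpen V
  smooth : ∀ x ∈ V, MatSmoothAt g x
  symm : ∀ x ∈ V, (g x)ᵀ = g x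
  det_ne : ∀ x ∈ V, (g x).det ≠ 0

/-- The connection matrices `(Γ_a)^c_b`. -/
noncomputable def connMat (g : R3 → Matrix (Fin 3) (Fin 3) ℂ) (a : Fin 3) (x : R3) :
    Matrix (Fin 3) (Fin 3) ℂ :=
  Matrix.of fun c b => christoffel g x c a b

/-- The curvature matrices `(R_{ab})^c_d`. -/
noncomputable def curvMat (g : R3 → Matrix (Fin 3) (Fin 3) ℂ) (a b : Fin 3) (x : R3) :
    Matrix (Fin 3) (Fin 3) ℂ :=
  Matrix.of fun c d => riemann g x a b d c

variable {g : R3 → Matrix (Fin 3) (Fin 3) ℂ} {V : Set R3} {x : R3}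

theorem curvMat_eq (a b : Fin 3) :
    curvMat g a b x = pdMat a (connMat g b) x - pdMat b (connMat g a) x
      + (connMat g a x * connMat g b x - connMat g b x * connMat g a x) := by
  ext c d
  simp [curvMat, riemann, connMat, pdMat, Matrix.mul_apply, Finset.sum_sub_distrib]

theorem curvMat_skew (a b : Fin 3) : curvMat g a b x = -curvMat g b a x := by
  rw [curvMat_eq, curvMat_eq]
  abel

namespace IsLocalMetric

variable (hg : IsLocalMetric g V)
include hg

theorem mem_nhds (hx : x ∈ V) : V ∈ nhds x := hg.isOpen.mem_nhds hx

theorem mul_inv (hx : x ∈ V) : g x * (g x)⁻¹ = 1 :=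
  Matrix.mul_nonsing_inv _ (hg.det_ne x hx).isUnit

theorem inv_mul (hx : x ∈ V) : (g x)⁻¹ * g x = 1 :=
  Matrix.nonsing_inv_mul _ (hg.det_ne x hx).isUnit

theorem inv_symm (hx : x ∈ V) : ((g x)⁻¹)ᵀ = (g x)⁻¹ := by
  rw [Matrix.transpose_nonsing_inv, hg.symm x hx]

theorem apply_symm (hx : x ∈ V) (a b : Fin 3) : g x a b = g x b a :=
  congrFun (congrFun (hg.symm x hx) b) a

/-- By Cramer's rule the entries are polynomials in the entries of g divided by the nonvanishing
determinant. -/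
theorem smooth_inv (hx : x ∈ V) : MatSmoothAt (fun y => (g y)⁻¹) x := by
  have s (i j) : ContDiffAt ℝ ∞ (fun y => g y i j) x := hg.smooth x hx i j
  have hdet : ContDiffAt ℝ ∞ (fun y => (g y).det) x := by
    simp only [Matrix.det_fin_three]
    fun_prop
  have hadj : MatSmoothAt (fun y => (g y).adjugate) x := fun i j => by
    simp only [Matrix.adjugate_fin_three]
    fin_cases i <;> fin_cases j <;> simp <;> fun_prop
  intro i j
  simp only [Matrix.inv_def, Ring.inverse_eq_inv', Matrix.smul_apply, smul_eq_mul]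
  exact (hdet.inv (hg.det_ne x hx)).mul (hadj i j)

theorem smooth_christoffel (hx : x ∈ V) (c a b : Fin 3) :
    ContDiffAt ℝ ∞ (fun y => christoffel g y c a b) x := by
  refine contDiffAt_const.mul (ContDiffAt.sum fun d _ => (hg.smooth_inv hx c d).mul ?_)
  exact ((contDiffAt_pd (hg.smooth x hx b d) a).add (contDiffAt_pd (hg.smooth x hx a d) b)).sub
    (contDiffAt_pd (hg.smooth x hx a b) d)

theorem smooth_connMat (hx : x ∈ V) (a : Fin 3) : MatSmoothAt (connMat g a) x :=
  fun c b => hg.smooth_christoffel hx c a b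

theorem pd_symm (hx : x ∈ V) (a b c : Fin 3) :
    pd a (fun y => g y b c) x = pd a (fun y => g y c b) x :=
  pd_congr a (Filter.mem_of_superset (hg.mem_nhds hx) fun _ hy => hg.apply_symm hy b c)

theorem connMat_symm (hx : x ∈ V) (a b c : Fin 3) : connMat g a x c b = connMat g b x c a := by
  simp only [connMat, christoffel, Matrix.of_apply]
  congr 1
  refine Finset.sum_congr rfl fun d _ => ?_
  rw [hg.pd_symm hx d a b]
  ring

theorem mul_connMat_apply (hx : x ∈ V) (a b e : Fin 3) :
    (g x * connMat g a x) e b = (1 / 2) * (pd a (fun y => g y b e) x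
      + pd b (fun y => g y a e) x - pd e (fun y => g y a b) x) := by
  have h1 : connMat g a x = (1 / 2 : ℂ) • ((g x)⁻¹ * Matrix.of fun d b =>
      (pd a (fun y => g y b d) x + pd b (fun y => g y a d) x - pd d (fun y => g y a b) x)) := by
    ext c b
    simp [connMat, christoffel, Matrix.mul_apply]
  rw [h1, Matrix.mul_smul, ← Matrix.mul_assoc, hg.mul_inv hx]
  simp

/-- Metric compatibility: symmetrising the lowered Christoffel symbols cancels two of the three
derivative terms. -/
theorem pdMat_metric (hx : x ∈ V) (a : Fin 3) :
    pdMat a g x = (connMat g a x)ᵀ * g x + g x * connMat g a x := by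
  have h : (connMat g a x)ᵀ * g x = (g x * connMat g a x)ᵀ := by
    rw [Matrix.transpose_mul, hg.symm x hx]
  ext e b
  rw [h, Matrix.add_apply, Matrix.transpose_apply, hg.mul_connMat_apply hx,
    hg.mul_connMat_apply hx, hg.pd_symm hx a b e]
  simp only [pdMat, Matrix.of_apply]
  ring

theorem pdMat_inv (hx : x ∈ V) (a : Fin 3) :
    pdMat a (fun y => (g y)⁻¹) x =
      -(connMat g a x * (g x)⁻¹ + (g x)⁻¹ * (connMat g a x)ᵀ) := by
  have h1 : pdMat a (fun y => g y * (g y)⁻¹) x = 0 := by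
    rw [pdMat_congr (F' := fun _ => 1) a
      (Filter.mem_of_superset (hg.mem_nhds hx) fun y hy => hg.mul_inv hy), pdMat_const]
  rw [pdMat_mul a (hg.smooth x hx) (hg.smooth_inv hx), hg.pdMat_metric hx] at h1
  have h2 := congrArg (fun A => (g x)⁻¹ * A) h1
  simp only [Matrix.mul_add, Matrix.add_mul, Matrix.mul_assoc, hg.mul_inv hx, Matrix.mul_one,
    Matrix.mul_zero] at h2
  rw [← Matrix.mul_assoc _ (g x) (pdMat _ _ _), ← Matrix.mul_assoc _ (g x) (connMat _ _ _ * _),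
    hg.inv_mul hx, Matrix.one_mul, Matrix.one_mul] at h2
  rw [eq_neg_iff_add_eq_zero, ← h2]
  abel

theorem smooth_curvMat (hx : x ∈ V) (a b : Fin 3) : MatSmoothAt (curvMat g a b) x := by
  intro c d
  simp only [curvMat, riemann, Matrix.of_apply]
  refine ((contDiffAt_pd (hg.smooth_christoffel hx _ _ _) _).sub
    (contDiffAt_pd (hg.smooth_christoffel hx _ _ _) _)).add (ContDiffAt.sum fun e _ => ?_)
  exact ((hg.smooth_christoffel hx _ _ _).mul (hg.smooth_christoffel hx _ _ _)).sub
    ((hg.smooth_christoffel hx _ _ _).mul (hg.smooth_christoffel hx _ _ _))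

/-- The second Bianchi identity for the curvature matrices. -/
theorem pdMat_curvMat_cyclic (hx : x ∈ V) (e a b : Fin 3) :
    (pdMat e (curvMat g a b) x + connMat g e x * curvMat g a b x
        - curvMat g a b x * connMat g e x)
      + (pdMat a (curvMat g b e) x + connMat g a x * curvMat g b e x
        - curvMat g b e x * connMat g a x)
      + (pdMat b (curvMat g e a) x + connMat g b x * curvMat g e a x
        - curvMat g e a x * connMat g b x) = 0 := by
  have s (a) := hg.smooth_connMat hx a
  have key (e a b : Fin 3) : pdMat e (curvMat g a b) x =
      pdMat e (pdMat a (connMat g b)) x - pdMat e (pdMat b (connMat g a)) x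
      + (pdMat e (connMat g a) x * connMat g b x + connMat g a x * pdMat e (connMat g b) x
        - (pdMat e (connMat g b) x * connMat g a x
          + connMat g b x * pdMat e (connMat g a) x)) := by
    rw [pdMat_congr e (Filter.mem_of_superset (hg.mem_nhds hx) fun y _ => curvMat_eq a b),
      pdMat_add e (((s b).pdMat a).sub ((s a).pdMat b)) (((s a).mul (s b)).sub ((s b).mul (s a))),
      pdMat_sub e ((s b).pdMat a) ((s a).pdMat b),
      pdMat_sub e ((s a).mul (s b)) ((s b).mul (s a)), pdMat_mul e (s a) (s b),
      pdMat_mul e (s b) (s a)]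
  -- Once second derivatives of the connection matrices commute, what remains is the Jacobi identity
  -- for the matrix commutator.
  rw [key, key, key, curvMat_eq, curvMat_eq, curvMat_eq,
    pdMat_comm e a (s b), pdMat_comm b e (s a), pdMat_comm a b (s e)]
  noncomm_ring

/-- The curvature takes values in the orthogonal Lie algebra. -/
theorem curvMat_orthogonal (hx : x ∈ V) (a b : Fin 3) :
    (curvMat g a b x)ᵀ * g x + g x * curvMat g a b x = 0 := by
  have s (a) := hg.smooth_connMat hx a
  have sg := hg.smooth x hx
  have key (a b : Fin 3) : pdMat a (pdMat b g) x =
      (pdMat a (connMat g b) x)ᵀ * g x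
        + (connMat g b x)ᵀ * ((connMat g a x)ᵀ * g x + g x * connMat g a x)
        + (((connMat g a x)ᵀ * g x + g x * connMat g a x) * connMat g b x
          + g x * pdMat a (connMat g b) x) := by
    rw [pdMat_congr a (Filter.mem_of_superset (hg.mem_nhds hx) fun y hy => hg.pdMat_metric hy b),
      pdMat_add a ((s b).transpose.mul sg) (sg.mul (s b)), pdMat_mul a (s b).transpose sg,
      pdMat_mul a sg (s b), pdMat_transpose, hg.pdMat_metric hx]
  -- Antisymmetrising the second derivatives of g, each expressed through metric compatibility,
  -- leaves exactly the curvature term.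
  have h := pdMat_comm a b sg
  rw [key, key] at h
  rw [curvMat_eq]
  simp only [Matrix.transpose_add, Matrix.transpose_sub, Matrix.transpose_mul]
  rw [← sub_eq_zero] at h
  rw [← h]
  noncomm_ring

/-- The first Bianchi identity. -/
theorem curvMat_cyclic (hx : x ∈ V) (a b d c : Fin 3) :
    curvMat g a b x c d + curvMat g b d x c a + curvMat g d a x c b = 0 := by
  have hc (a b c : Fin 3) : ∀ y ∈ V, christoffel g y c a b = christoffel g y c b a :=
    fun y hy => hg.connMat_symm hy a b c
  have hp (e a b c : Fin 3) : pd e (fun y => christoffel g y c a b) x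
      = pd e (fun y => christoffel g y c b a) x :=
    pd_congr e (Filter.mem_of_superset (hg.mem_nhds hx) (hc a b c))
  have h1 : ∀ e, christoffel g x e b d = christoffel g x e d b := fun e => hc _ _ _ x hx
  have h2 : ∀ e, christoffel g x e a d = christoffel g x e d a := fun e => hc _ _ _ x hx
  have h3 : ∀ e, christoffel g x e a b = christoffel g x e b a := fun e => hc _ _ _ x hx
  simp only [curvMat, riemann, Matrix.of_apply, Finset.sum_sub_distrib, h1, h2, h3, hp a b d,
    hp b a d, hp d a b]
  ring

end IsLocalMetric

end NullGeom

namespace NullGeom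

/-! ### The contracted Bianchi identity -/

open Matrix

variable {g : R3 → Matrix (Fin 3) (Fin 3) ℂ} {V : Set R3} {x : R3}

/-- The covariant derivative `∇_e R_{ab}` of the curvature, as a matrix in the last two indices. -/
noncomputable def covDerivCurv (g : R3 → Matrix (Fin 3) (Fin 3) ℂ) (x : R3) (e a b : Fin 3) :
    Matrix (Fin 3) (Fin 3) ℂ :=
  pdMat e (curvMat g a b) x + connMat g e x * curvMat g a b x - curvMat g a b x * connMat g e x
    - ∑ f, connMat g e x f a • curvMat g f b x - ∑ f, connMat g e x f b • curvMat g a f x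

/-- The matrix of the Ricci tensor. -/
noncomputable def ricciMat (g : R3 → Matrix (Fin 3) (Fin 3) ℂ) (x : R3) :
    Matrix (Fin 3) (Fin 3) ℂ :=
  Matrix.of fun a b => ricci g x a b

theorem ricciMat_apply (a b : Fin 3) : ricciMat g x a b = ∑ c, curvMat g a c x c b := rfl

theorem ricciScalar_eq : ricciScalar g x = ∑ a, ∑ b, (g x)⁻¹ a b * ricciMat g x a b := rfl

theorem covDerivTwo_eq (T : R3 → Matrix (Fin 3) (Fin 3) ℂ) (c a b : Fin 3) :
    covDerivTwo g x T c a b =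
      (pdMat c T x - (connMat g c x)ᵀ * T x - T x * connMat g c x) a b := by
  simp [covDerivTwo, pdMat, connMat, Matrix.mul_apply, mul_comm]

/-- Contraction of the cyclic identity for a tensor with the symmetries of `∇_e R_{abc}{}^d`. -/
theorem contracted_cyclic (H : Matrix (Fin 3) (Fin 3) ℂ) (hH : Hᵀ = H)
    (D : Fin 3 → Fin 3 → Fin 3 → Matrix (Fin 3) (Fin 3) ℂ)
    (hcyc : ∀ e a b, D e a b + D a b e + D b e a = 0)
    (hskew : ∀ e a b, D e a b = -D e b a)
    (horth : ∀ e a b, D e a b * H + H * (D e a b)ᵀ = 0) (e : Fin 3) :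
    ∑ a, ∑ d, H a d * ∑ b, D e a b b d = 2 * ∑ a, ∑ d, H a d * ∑ b, D a e b b d := by
  -- The second cyclic term is minus the divergence by skewness in the form indices. The third is
  -- too, because raising an index makes each matrix skew.
  have h1 : ∑ a, ∑ d, H a d * ∑ b, D a b e b d = -∑ a, ∑ d, H a d * ∑ b, D a e b b d := by
    simp only [fun a b => hskew a b e, Matrix.neg_apply, Finset.sum_neg_distrib, mul_neg]
  have h2 : ∑ a, ∑ d, H a d * ∑ b, D b e a b d = -∑ b, ∑ d, H b d * ∑ a, D b e a a d := by
    have l : ∑ a, ∑ d, H a d * ∑ b, D b e a b d = ∑ b, ∑ a, (D b e a * H) b a := by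
      simp only [Matrix.mul_apply, Finset.mul_sum]
      rw [Finset.sum_congr rfl fun a _ => Finset.sum_comm, Finset.sum_comm]
      refine Finset.sum_congr rfl fun b _ => Finset.sum_congr rfl fun a _ =>
        Finset.sum_congr rfl fun d _ => ?_
      rw [← congrFun (congrFun hH a) d, Matrix.transpose_apply, mul_comm]
    have r : ∑ b, ∑ d, H b d * ∑ a, D b e a a d = ∑ b, ∑ a, (H * (D b e a)ᵀ) b a := by
      simp only [Matrix.mul_apply, Finset.mul_sum, Matrix.transpose_apply]
      exact Finset.sum_congr rfl fun b _ => Finset.sum_comm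
    rw [l, r, ← Finset.sum_neg_distrib]
    refine Finset.sum_congr rfl fun b _ => ?_
    rw [← Finset.sum_neg_distrib]
    refine Finset.sum_congr rfl fun a _ => ?_
    exact eq_neg_of_add_eq_zero_left (congrFun (congrFun (horth b e a) b) a)
  have h3 : ∑ a, ∑ d, H a d * ∑ b, D e a b b d + ∑ a, ∑ d, H a d * ∑ b, D a b e b d
      + ∑ a, ∑ d, H a d * ∑ b, D b e a b d = 0 := by
    simp only [← Finset.sum_add_distrib, ← mul_add]
    refine Finset.sum_eq_zero fun a _ => Finset.sum_eq_zero fun d _ => ?_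
    rw [Finset.sum_eq_zero, mul_zero]
    exact fun b _ => congrFun (congrFun (hcyc e a b) b) d
  linear_combination h3 - h1 - h2

namespace IsLocalMetric

variable (hg : IsLocalMetric g V)
include hg

theorem smooth_ricciMat (hx : x ∈ V) : MatSmoothAt (ricciMat g) x := fun a b => by
  simp only [ricciMat_apply]
  exact ContDiffAt.sum fun c _ => hg.smooth_curvMat hx a c c b

theorem smooth_ricciScalar (hx : x ∈ V) : ContDiffAt ℝ ∞ (ricciScalar g) x :=
  ContDiffAt.sum fun a _ => ContDiffAt.sum fun b _ =>
    (hg.smooth_inv hx a b).mul (hg.smooth_ricciMat hx a b)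

theorem curvMat_mul_inv (hx : x ∈ V) (a b : Fin 3) :
    curvMat g a b x * (g x)⁻¹ + (g x)⁻¹ * (curvMat g a b x)ᵀ = 0 := by
  have h := congrArg (fun A => (g x)⁻¹ * A * (g x)⁻¹) (hg.curvMat_orthogonal hx a b)
  simp only [Matrix.mul_add, Matrix.add_mul, Matrix.mul_assoc, hg.mul_inv hx, Matrix.mul_one,
    Matrix.mul_zero, Matrix.zero_mul] at h
  rw [← Matrix.mul_assoc _ (g x), hg.inv_mul hx, Matrix.one_mul] at h
  rw [← h]
  abel

/-- By `curvMat_mul_inv` the curvature is similar under g to minus its transpose, so its trace is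
its own negative. -/
theorem trace_curvMat (hx : x ∈ V) (a b : Fin 3) : (curvMat g a b x).trace = 0 := by
  have h := congrArg (fun A => (A * g x).trace) (hg.curvMat_mul_inv hx a b)
  simp only [Matrix.add_mul, Matrix.mul_assoc, hg.inv_mul hx, Matrix.mul_one,
    Matrix.trace_add, Matrix.zero_mul, Matrix.trace_zero] at h
  rw [Matrix.trace_mul_comm, Matrix.mul_assoc, hg.mul_inv hx, Matrix.mul_one,
    Matrix.trace_transpose, ← two_mul] at h
  simpa using h

/-- Contract the first Bianchi identity; the leftover term is a trace of the curvature, which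
vanishes. -/
theorem ricciMat_symm (hx : x ∈ V) (a b : Fin 3) : ricciMat g x a b = ricciMat g x b a := by
  have h : ∑ c, (curvMat g a c x c b + curvMat g c b x c a + curvMat g b a x c c) = 0 :=
    Finset.sum_eq_zero fun c _ => hg.curvMat_cyclic hx a c b c
  have hs : ∑ c, curvMat g c b x c a = -∑ c, curvMat g b c x c a := by
    simp only [fun c => curvMat_skew (g := g) (x := x) c b, Matrix.neg_apply,
      Finset.sum_neg_distrib]
  rw [Finset.sum_add_distrib, Finset.sum_add_distrib, hs] at h
  have ht := hg.trace_curvMat hx b a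
  simp only [Matrix.trace, Matrix.diag_apply] at ht
  rw [ricciMat_apply, ricciMat_apply]
  linear_combination h - ht

/-- The Christoffel terms acting on the form indices cancel in pairs, since Γ is symmetric in its
lower indices and the curvature is skew; the rest is the matrix Bianchi identity. -/
theorem covDerivCurv_cyclic (hx : x ∈ V) (e a b : Fin 3) :
    covDerivCurv g x e a b + covDerivCurv g x a b e + covDerivCurv g x b e a = 0 := by
  have hs (e a b : Fin 3) : ∑ f, connMat g a x f e • curvMat g b f x
      = -∑ f, connMat g e x f a • curvMat g f b x := by
    rw [← Finset.sum_neg_distrib]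
    refine Finset.sum_congr rfl fun f _ => ?_
    rw [hg.connMat_symm hx a e f, curvMat_skew b f, smul_neg]
  rw [← hg.pdMat_curvMat_cyclic hx e a b]
  simp only [covDerivCurv]
  rw [hs e a b, hs a b e, hs b e a]
  abel

theorem covDerivCurv_skew (hx : x ∈ V) (e a b : Fin 3) :
    covDerivCurv g x e a b = -covDerivCurv g x e b a := by
  have hd : pdMat e (curvMat g a b) x = -pdMat e (curvMat g b a) x := by
    have h := pdMat_sub e (F := fun _ => 0) (F' := curvMat g b a) (x := x)
      (fun _ _ => contDiffAt_const) (hg.smooth_curvMat hx b a)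
    rw [pdMat_const, zero_sub] at h
    rw [← h]
    exact pdMat_congr e (Filter.mem_of_superset (hg.mem_nhds hx) fun y _ => by
      simp [curvMat_skew a b])
  have hs (a b : Fin 3) : ∑ f, connMat g e x f a • curvMat g f b x
      = -∑ f, connMat g e x f a • curvMat g b f x := by
    rw [← Finset.sum_neg_distrib]
    refine Finset.sum_congr rfl fun f _ => ?_
    rw [curvMat_skew b f, smul_neg, neg_neg]
  simp only [covDerivCurv]
  rw [hd, hs a b, hs b a, curvMat_skew a b]
  noncomm_ring

/-- Covariant differentiation preserves skewness because g is parallel. The derivative of the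
skewness relation is corrected by multiples of the relation itself: `hl`, `hr` for the matrix
indices and `hf` for the form indices. -/
theorem covDerivCurv_orthogonal (hx : x ∈ V) (e a b : Fin 3) :
    covDerivCurv g x e a b * (g x)⁻¹ + (g x)⁻¹ * (covDerivCurv g x e a b)ᵀ = 0 := by
  have sR := hg.smooth_curvMat hx a b
  have sH := hg.smooth_inv hx
  have h : pdMat e (fun y => curvMat g a b y * (g y)⁻¹ + (g y)⁻¹ * (curvMat g a b y)ᵀ) x = 0 := by
    rw [pdMat_congr (F' := fun _ => 0) e (Filter.mem_of_superset (hg.mem_nhds hx) fun y hy =>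
      hg.curvMat_mul_inv hy a b), pdMat_const]
  rw [pdMat_add e (sR.mul sH) (sH.mul sR.transpose), pdMat_mul e sR sH,
    pdMat_mul e sH sR.transpose, pdMat_transpose, hg.pdMat_inv hx] at h
  have h0 := hg.curvMat_mul_inv hx
  have hl := congrArg (fun A => connMat g e x * A) (h0 a b)
  have hr := congrArg (fun A => A * (connMat g e x)ᵀ) (h0 a b)
  have hf : ∑ f, connMat g e x f a • (curvMat g f b x * (g x)⁻¹ + (g x)⁻¹ * (curvMat g f b x)ᵀ)
      + ∑ f, connMat g e x f b • (curvMat g a f x * (g x)⁻¹ + (g x)⁻¹ * (curvMat g a f x)ᵀ)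
      = 0 := by
    simp [h0]
  simp only [smul_add, Finset.sum_add_distrib, Matrix.mul_zero, Matrix.zero_mul] at hf hl hr
  simp only [covDerivCurv, Matrix.transpose_sub, Matrix.transpose_add, Matrix.transpose_mul,
    Matrix.transpose_sum, Matrix.transpose_smul, Matrix.sub_mul, Matrix.mul_sub, Matrix.add_mul,
    Matrix.mul_add, Matrix.sum_mul, Matrix.mul_sum, Matrix.smul_mul, Matrix.mul_smul]
  have h5 := congrArg₂ (· - ·) (congrArg₂ (· + ·) h (congrArg₂ (· + ·) hl hr)) hf
  simp only [add_zero, sub_zero] at h5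
  rw [← h5]
  noncomm_ring

theorem covDerivTwo_ricciMat (hx : x ∈ V) (e a d : Fin 3) :
    covDerivTwo g x (ricciMat g) e a d = ∑ b, covDerivCurv g x e a b b d := by
  have h : pd e (fun y => ricciMat g y a d) x = ∑ b, pdMat e (curvMat g a b) x b d := by
    simp only [ricciMat_apply]
    exact pd_sum e _ fun b _ => hg.smooth_curvMat hx a b b d
  rw [covDerivTwo, h]
  simp only [covDerivCurv, ricciMat_apply, Matrix.sub_apply, Matrix.add_apply, Matrix.mul_apply,
    Matrix.smul_apply, smul_eq_mul, Fin.sum_univ_three, connMat,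
    Matrix.of_apply]
  ring

/-- Contraction with the inverse metric commutes with the covariant derivative. -/
theorem pd_contract (hx : x ∈ V) {T : R3 → Matrix (Fin 3) (Fin 3) ℂ} (hT : MatSmoothAt T x)
    (e : Fin 3) :
    pd e (fun y => ∑ a, ∑ b, (g y)⁻¹ a b * T y a b) x
      = ∑ a, ∑ b, (g x)⁻¹ a b * covDerivTwo g x T e a b := by
  have sH := hg.smooth_inv hx
  have hH (a b : Fin 3) : pd e (fun y => (g y)⁻¹ a b) x =
      -(connMat g e x * (g x)⁻¹ + (g x)⁻¹ * (connMat g e x)ᵀ) a b :=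
    congrFun (congrFun (hg.pdMat_inv hx e) a) b
  have hp (a : Fin 3) : pd e (fun y => ∑ b, (g y)⁻¹ a b * T y a b) x
      = ∑ b, (pd e (fun y => (g y)⁻¹ a b) x * T x a b
        + (g x)⁻¹ a b * pd e (fun y => T y a b) x) := by
    rw [pd_sum e _ fun b _ => (sH a b).mul (hT a b)]
    exact Finset.sum_congr rfl fun b _ => pd_mul e (sH a b) (hT a b)
  rw [pd_sum e _ fun a _ => ContDiffAt.sum fun b _ => (sH a b).mul (hT a b),
    Finset.sum_congr rfl fun a _ => hp a]
  simp only [hH, covDerivTwo, Matrix.add_apply, Matrix.mul_apply,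
    Matrix.transpose_apply, connMat, Matrix.of_apply, Fin.sum_univ_three]
  ring

theorem pd_ricciScalar (hx : x ∈ V) (e : Fin 3) :
    pd e (ricciScalar g) x =
      2 * ∑ a, ∑ d, (g x)⁻¹ a d * covDerivTwo g x (ricciMat g) a e d := by
  have h := hg.pd_contract hx (hg.smooth_ricciMat hx) e
  simp only [hg.covDerivTwo_ricciMat hx] at h ⊢
  rw [← contracted_cyclic _ (hg.inv_symm hx) (covDerivCurv g x) (hg.covDerivCurv_cyclic hx)
    (hg.covDerivCurv_skew hx) (hg.covDerivCurv_orthogonal hx), ← h]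
  rfl

end IsLocalMetric

end NullGeom

namespace NullGeom

/-! ### The tracefree Ricci tensor and the Cotton tensor -/

open Matrix

variable {g : R3 → Matrix (Fin 3) (Fin 3) ℂ} {V : Set R3} {x : R3}

namespace IsLocalMetric

variable (hg : IsLocalMetric g V)
include hg

theorem smooth_scalS (hx : x ∈ V) : ContDiffAt ℝ ∞ (scalS g) x :=
  contDiffAt_const.mul (hg.smooth_ricciScalar hx)

theorem gradS_eq (hx : x ∈ V) (c : Fin 3) : gradS g x c = (1 / 12) * pd c (ricciScalar g) x := by
  have h := pd_mul c (f := fun _ => 1 / 12) (contDiffAt_const (x := x)) (hg.smooth_ricciScalar hx)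
  rw [pd_const, zero_mul, zero_add] at h
  exact h

theorem smooth_tracefreeRicci (hx : x ∈ V) : MatSmoothAt (tracefreeRicci g) x := fun a b =>
  (hg.smooth_ricciMat hx a b).sub
    ((contDiffAt_const.mul (hg.smooth_ricciScalar hx)).mul (hg.smooth x hx a b))

theorem tracefreeRicci_symm (hx : x ∈ V) (a b : Fin 3) :
    tracefreeRicci g x a b = tracefreeRicci g x b a := by
  have h := hg.ricciMat_symm hx a b
  simp only [ricciMat, Matrix.of_apply] at h
  simp only [tracefreeRicci, Matrix.of_apply, h, hg.apply_symm hx a b]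

theorem trace_inv_mul_tracefreeRicci (hx : x ∈ V) :
    ((g x)⁻¹ * tracefreeRicci g x).trace = 0 := by
  have h1 : tracefreeRicci g x = ricciMat g x - ((1 / 3) * ricciScalar g x) • g x := by
    ext a b
    simp [tracefreeRicci, ricciMat]
  have h2 : ((g x)⁻¹ * ricciMat g x).trace = ricciScalar g x := by
    simp only [ricciScalar_eq, Matrix.trace, Matrix.diag_apply, Matrix.mul_apply]
    exact Finset.sum_congr rfl fun a _ => Finset.sum_congr rfl fun b _ => by
      rw [hg.ricciMat_symm hx a b]
  rw [h1, Matrix.mul_sub, Matrix.trace_sub, h2, Matrix.mul_smul, hg.inv_mul hx,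
    Matrix.trace_smul, Matrix.trace_one]
  simp
  ring

/-- The metric is covariantly constant. -/
theorem covDerivTwo_smul_add_smul (hx : x ∈ V) {T : R3 → Matrix (Fin 3) (Fin 3) ℂ}
    (hT : MatSmoothAt T x) {f : R3 → ℂ} (hf : ContDiffAt ℝ ∞ f x) (s : ℂ) (c a b : Fin 3) :
    covDerivTwo g x (fun y => Matrix.of fun a b => s * T y a b + f y * g y a b) c a b
      = s * covDerivTwo g x T c a b + pd c f x * g x a b := by
  have h : pd c (fun y => s * T y a b + f y * g y a b) x =
      s * pd c (fun y => T y a b) x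
        + (pd c f x * g x a b + f x * pd c (fun y => g y a b) x) := by
    rw [pd_add c (contDiffAt_const.mul (hT a b)) (hf.mul (hg.smooth x hx a b)),
      pd_mul c contDiffAt_const (hT a b), pd_mul c hf (hg.smooth x hx a b), pd_const]
    ring
  have hG : pd c (fun y => g y a b) x =
      ((connMat g c x)ᵀ * g x + g x * connMat g c x) a b :=
    congrFun (congrFun (hg.pdMat_metric hx c) a) b
  simp only [covDerivTwo, Matrix.of_apply, h, hG, Matrix.add_apply, Matrix.mul_apply, connMat,
    Matrix.transpose_apply, Fin.sum_univ_three]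
  ring

theorem covDerivTwo_tracefreeRicci (hx : x ∈ V) (c a b : Fin 3) :
    covDerivTwo g x (tracefreeRicci g) c a b =
      covDerivTwo g x (ricciMat g) c a b - 4 * gradS g x c * g x a b := by
  have hf := pd_mul c (f := fun _ => -(1 / 3)) (contDiffAt_const (x := x))
    (hg.smooth_ricciScalar hx)
  have h := hg.covDerivTwo_smul_add_smul hx (hg.smooth_ricciMat hx)
    (contDiffAt_const.mul (hg.smooth_ricciScalar hx)) 1 (f := fun y => -(1 / 3) * ricciScalar g y)
    c a b
  have he : tracefreeRicci g = fun y => Matrix.of fun a b =>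
      1 * ricciMat g y a b + -(1 / 3) * ricciScalar g y * g y a b := by
    ext y a b
    simp [tracefreeRicci, ricciMat]
    ring
  rw [he, h, hf, pd_const, hg.gradS_eq hx]
  ring

theorem covDerivTwo_schouten (hx : x ∈ V) (c a b : Fin 3) :
    covDerivTwo g x (schouten g) c a b =
      -covDerivTwo g x (tracefreeRicci g) c a b - gradS g x c * g x a b := by
  have hf := pd_mul c (f := fun _ => -1) (contDiffAt_const (x := x)) (hg.smooth_scalS hx)
  have h := hg.covDerivTwo_smul_add_smul hx (hg.smooth_tracefreeRicci hx)
    (contDiffAt_const.mul (hg.smooth_scalS hx)) (-1) (f := fun y => -1 * scalS g y) c a b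
  have he : schouten g = fun y => Matrix.of fun a b =>
      -1 * tracefreeRicci g y a b + -1 * scalS g y * g y a b := by
    ext y a b
    simp [schouten, scalS]
    ring
  rw [he, h, hf, pd_const, gradS]
  ring

/-- Isolates ∇Φ, to which the eigenvector equation applies, from the gradient of S. -/
theorem cotton_eq (hx : x ∈ V) (a b c : Fin 3) :
    cotton g x a b c = covDerivTwo g x (tracefreeRicci g) c b a
      - covDerivTwo g x (tracefreeRicci g) b c a
      + gradS g x c * g x b a - gradS g x b * g x c a := by
  rw [cotton, hg.covDerivTwo_schouten hx, hg.covDerivTwo_schouten hx]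
  ring

theorem covDerivTwo_tracefreeRicci_symm (hx : x ∈ V) (c a b : Fin 3) :
    covDerivTwo g x (tracefreeRicci g) c a b = covDerivTwo g x (tracefreeRicci g) c b a := by
  have h := pd_congr c (Filter.mem_of_superset (hg.mem_nhds hx) fun y hy =>
    hg.tracefreeRicci_symm hy a b)
  simp only [covDerivTwo, h, fun d => hg.tracefreeRicci_symm hx d b,
    fun d => hg.tracefreeRicci_symm hx d a]
  ring

/-- The contracted Bianchi identity for the tracefree Ricci tensor. -/
theorem div_tracefreeRicci (hx : x ∈ V) (e : Fin 3) :
    ∑ a, ∑ d, (g x)⁻¹ a d * covDerivTwo g x (tracefreeRicci g) a e d = 2 * gradS g x e := by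
  have h1 := hg.pd_ricciScalar hx e
  have h2 : ∑ a, ∑ d, (g x)⁻¹ a d * (gradS g x a * g x e d) = gradS g x e := by
    have h (a : Fin 3) : ∑ d, (g x)⁻¹ a d * (gradS g x a * g x e d)
        = gradS g x a * (1 : Matrix (Fin 3) (Fin 3) ℂ) a e := by
      rw [← hg.inv_mul hx, Matrix.mul_apply, Finset.mul_sum]
      refine Finset.sum_congr rfl fun d _ => ?_
      rw [hg.apply_symm hx e d]
      ring
    simp [h, Matrix.one_apply]
  have h3 : ∑ a, ∑ d, (g x)⁻¹ a d * covDerivTwo g x (tracefreeRicci g) a e d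
      = ∑ a, ∑ d, (g x)⁻¹ a d * covDerivTwo g x (ricciMat g) a e d
        - 4 * ∑ a, ∑ d, (g x)⁻¹ a d * (gradS g x a * g x e d) := by
    simp only [hg.covDerivTwo_tracefreeRicci hx, Finset.mul_sum, ← Finset.sum_sub_distrib]
    exact Finset.sum_congr rfl fun a _ => Finset.sum_congr rfl fun d _ => by ring
  rw [h3, h2]
  linear_combination (-6) * hg.gradS_eq hx e - (1 / 2) * h1

end IsLocalMetric

end NullGeom

namespace NullGeom

/-! ### The local generator of a co-geodetic null structure -/

open Matrix

variable {g : R3 → Matrix (Fin 3) (Fin 3) ℂ} {V : Set R3} {x : R3}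

/-- For a covector field `K` with `K_i = 1`, the projection `∂_a - K_a ∂_i` of `∂_a` to the
annihilator of `K`. -/
noncomputable def annField (K : R3 → Matrix (Fin 3) (Fin 1) ℂ) (i a : Fin 3) (y : R3) :
    Fin 3 → ℂ :=
  fun c => (Pi.single a 1 : Fin 3 → ℂ) c - K y a 0 * (Pi.single i 1 : Fin 3 → ℂ) c

/-- The covariant derivative `∇_c K_a` of a covector field. -/
noncomputable def covDerivCov (g : R3 → Matrix (Fin 3) (Fin 3) ℂ)
    (K : R3 → Matrix (Fin 3) (Fin 1) ℂ) (x : R3) (c : Fin 3) : Matrix (Fin 3) (Fin 1) ℂ :=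
  pdMat c K x - (connMat g c x)ᵀ * K x

/-- A null covector field normalised by `K_i = 1` whose annihilator is totally geodesic. -/
structure IsCoGeodeticCovector (g : R3 → Matrix (Fin 3) (Fin 3) ℂ) (V : Set R3) (i : Fin 3)
    (K : R3 → Matrix (Fin 3) (Fin 1) ℂ) : Prop where
  smooth : ∀ x ∈ V, MatSmoothAt K x
  norm : ∀ x ∈ V, K x i 0 = 1
  null : ∀ x ∈ V, (K x)ᵀ * (g x)⁻¹ * K x = 0
  geo : ∀ x ∈ V, ∀ a b, ∑ c, covDerivVec g x (annField K i a) (annField K i b) c * K x c 0 = 0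

variable {i : Fin 3} {K : R3 → Matrix (Fin 3) (Fin 1) ℂ}

/-- Differentiating an eigenvector equation for a field of bilinear forms. -/
theorem covDerivTwo_eigen (hg : IsLocalMetric g V) (hx : x ∈ V)
    {T : R3 → Matrix (Fin 3) (Fin 3) ℂ} (hT : MatSmoothAt T x) (hK : MatSmoothAt K x)
    {μ : R3 → ℂ} (hμ : ContDiffAt ℝ ∞ μ x)
    (h : ∀ y ∈ V, T y * (g y)⁻¹ * K y = μ y • K y) (c a : Fin 3) :
    ∑ b, covDerivTwo g x T c a b * ((g x)⁻¹ * K x) b 0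
      + (T x * (g x)⁻¹ * covDerivCov g K x c) a 0
      = pd c μ x * K x a 0 + μ x * covDerivCov g K x c a 0 := by
  have hd : pdMat c (fun y => μ y • K y) x = pd c μ x • K x + μ x • pdMat c K x := by
    ext a b
    exact pd_mul c hμ (hK a b)
  have h1 := pdMat_congr c (Filter.mem_of_superset (hg.mem_nhds hx) h)
  rw [pdMat_mul c (hT.mul (hg.smooth_inv hx)) hK, pdMat_mul c hT (hg.smooth_inv hx), hd,
    hg.pdMat_inv hx] at h1
  -- Adding Γᵀ times the undifferentiated equation turns the partial derivatives into covariant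
  -- ones.
  have h2 := congrArg (fun A => (connMat g c x)ᵀ * A) (h x hx)
  simp only [Matrix.mul_smul] at h2
  have h3 : (pdMat c T x - (connMat g c x)ᵀ * T x - T x * connMat g c x) * ((g x)⁻¹ * K x)
      + T x * (g x)⁻¹ * covDerivCov g K x c
      = pd c μ x • K x + μ x • covDerivCov g K x c := by
    rw [covDerivCov, smul_sub, ← h2, ← add_sub_assoc, ← h1]
    simp only [Matrix.mul_add, Matrix.add_mul, Matrix.mul_sub, Matrix.sub_mul, Matrix.mul_assoc,
      Matrix.mul_neg, Matrix.neg_mul]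
    abel
  have h4 := congrFun (congrFun h3 a) 0
  simp only [covDerivTwo_eq]
  exact h4

namespace IsCoGeodeticCovector

variable (hK : IsCoGeodeticCovector g V i K)
include hK

theorem pd_norm (hg : IsLocalMetric g V) (hx : x ∈ V) (c : Fin 3) :
    pd c (fun y => K y i 0) x = 0 := by
  rw [pd_congr (h := fun _ => 1) c (Filter.mem_of_superset (hg.mem_nhds hx) hK.norm), pd_const]

/-- On sections Y annihilated by K, K(∇_X Y) = −(∇_X K)(Y), so geodesy kills ∇K on pairs of
annihilated vectors. Expanding on X = ∂_a − K_a∂_i and Y = ∂_b − K_b∂_i gives this formula. -/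
theorem covDerivCov_eq (hg : IsLocalMetric g V) (hx : x ∈ V) (a b : Fin 3) :
    covDerivCov g K x a b 0 =
      K x a 0 * (covDerivCov g K x i b 0 - covDerivCov g K x i i 0 * K x b 0)
        + covDerivCov g K x a i 0 * K x b 0 := by
  have hp (e c : Fin 3) : pd e (fun y => annField K i b y c) x
      = -(pd e (fun y => K y b 0) x * (Pi.single i 1 : Fin 3 → ℂ) c) := by
    simp only [annField]
    rw [pd_sub e contDiffAt_const ((hK.smooth x hx b 0).mul contDiffAt_const), pd_const,
      pd_mul e (hK.smooth x hx b 0) contDiffAt_const, pd_const]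
    ring
  have h := hK.geo x hx a b
  simp only [covDerivVec, hp] at h
  have hn := hK.norm x hx
  have hnab (e b : Fin 3) : covDerivCov g K x e b 0
      = pd e (fun y => K y b 0) x - ∑ f, christoffel g x f e b * K x f 0 := by
    simp [covDerivCov, pdMat, connMat, Matrix.mul_apply]
  have h' : ∑ e, annField K i a x e *
      (covDerivCov g K x e b 0 - K x b 0 * covDerivCov g K x e i 0) = 0 := by
    rw [← neg_eq_zero, ← h]
    simp only [Finset.sum_mul]
    rw [Finset.sum_comm, ← Finset.sum_neg_distrib]
    refine Finset.sum_congr rfl fun e _ => ?_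
    have hs : ∑ c, (-(pd e (fun y => K y b 0) x * (Pi.single i 1 : Fin 3 → ℂ) c)
        + ∑ f, christoffel g x c e f * annField K i b x f) * K x c 0
        = -(covDerivCov g K x e b 0 - K x b 0 * covDerivCov g K x e i 0) := by
      have h1 (c : Fin 3) : ∑ f, christoffel g x c e f * annField K i b x f
          = christoffel g x c e b - K x b 0 * christoffel g x c e i := by
        simp [annField, mul_sub, Finset.sum_sub_distrib, Pi.single_apply, mul_comm]
      have h2 : ∑ c, -(pd e (fun y => K y b 0) x * (Pi.single i 1 : Fin 3 → ℂ) c) * K x c 0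
          = -pd e (fun y => K y b 0) x := by
        simp [Pi.single_apply, hn]
      simp only [h1, add_mul, Finset.sum_add_distrib, h2, sub_mul, Finset.sum_sub_distrib, hnab,
        hK.pd_norm hg hx, mul_assoc, ← Finset.mul_sum]
      ring
    rw [← mul_neg, ← hs, Finset.mul_sum]
    exact Finset.sum_congr rfl fun c _ => by ring
  simp only [annField, sub_mul, Finset.sum_sub_distrib, Pi.single_apply, mul_assoc, ite_mul,
    one_mul, zero_mul, ← Finset.mul_sum, Finset.sum_ite_eq', Finset.mem_univ, if_true] at h'
  linear_combination h'

/-- This is half the covariant derivative of the nullity relation K·g⁻¹K = 0. -/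
theorem inv_mul_covDerivCov (hg : IsLocalMetric g V) (hx : x ∈ V) (c : Fin 3) :
    ∑ b, ((g x)⁻¹ * K x) b 0 * covDerivCov g K x c b 0 = 0 := by
  have sK := hK.smooth x hx
  have sH := hg.smooth_inv hx
  have h := pdMat_congr c (Filter.mem_of_superset (hg.mem_nhds hx) hK.null)
  rw [pdMat_mul c (sK.transpose.mul sH) sK, pdMat_mul c sK.transpose sH, pdMat_transpose,
    hg.pdMat_inv hx] at h
  have hz : pdMat c (0 : R3 → Matrix (Fin 1) (Fin 1) ℂ) x = 0 := pdMat_const c 0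
  have h1 : (covDerivCov g K x c)ᵀ * ((g x)⁻¹ * K x)
      + ((g x)⁻¹ * K x)ᵀ * covDerivCov g K x c = 0 := by
    rw [← hz]
    refine Eq.trans ?_ h
    simp only [covDerivCov, Matrix.mul_add, Matrix.add_mul, Matrix.mul_sub, Matrix.sub_mul,
      Matrix.mul_assoc, Matrix.mul_neg, Matrix.neg_mul, Matrix.transpose_sub,
      Matrix.transpose_mul, Matrix.transpose_transpose, hg.inv_symm hx]
    abel
  generalize (g x)⁻¹ * K x = k at h1 ⊢
  have h2 := congrFun (congrFun h1 0) 0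
  simp only [Matrix.add_apply, Matrix.mul_apply, Matrix.transpose_apply, Matrix.zero_apply] at h2
  have h3 : ∑ b, covDerivCov g K x c b 0 * k b 0 = ∑ b, k b 0 * covDerivCov g K x c b 0 :=
    Finset.sum_congr rfl fun b _ => mul_comm _ _
  rw [h3, ← two_mul] at h2
  simpa using h2

theorem dual_null (hx : x ∈ V) : ∑ b, ((g x)⁻¹ * K x) b 0 * K x b 0 = 0 := by
  have h := congrFun (congrFun (hK.null x hx) 0) 0
  rw [Matrix.mul_assoc, Matrix.mul_apply] at h
  rw [Matrix.zero_apply] at h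
  rw [← h]
  exact Finset.sum_congr rfl fun b _ => mul_comm _ _

/-- The covariant derivative of a co-geodetic null covector. -/
theorem exists_covDerivCov_eq (hg : IsLocalMetric g V) (hx : x ∈ V) :
    ∃ u v : Fin 3 → ℂ, (∀ a b, covDerivCov g K x a b 0 = K x a 0 * u b + v a * K x b 0) ∧
      ∑ b, ((g x)⁻¹ * K x) b 0 * u b = 0 := by
  refine ⟨fun b => covDerivCov g K x i b 0 - covDerivCov g K x i i 0 * K x b 0,
    fun a => covDerivCov g K x a i 0, hK.covDerivCov_eq hg hx, ?_⟩
  have h1 := hK.inv_mul_covDerivCov hg hx i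
  have h2 := hK.dual_null hx
  simp only [mul_sub, Finset.sum_sub_distrib, h1, mul_left_comm _ (covDerivCov g K x i i 0),
    ← Finset.mul_sum, h2]
  ring

end IsCoGeodeticCovector

end NullGeom

namespace NullGeom

/-! ### The Cotton tensor along a multiple principal co-geodetic null structure -/

open Matrix

variable {g : R3 → Matrix (Fin 3) (Fin 3) ℂ} {V : Set R3} {x : R3}
  {i : Fin 3} {K : R3 → Matrix (Fin 3) (Fin 1) ℂ}

namespace IsCoGeodeticCovector

variable (hK : IsCoGeodeticCovector g V i K)
include hK

/-- Insert ∇K = K⊗u + v⊗K in the differentiated eigenvector equation: the v-terms on the two sides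
agree because K is itself an eigenvector. -/
theorem exists_covDerivTwo_tracefreeRicci (hg : IsLocalMetric g V) (hx : x ∈ V)
    {μ : R3 → ℂ} (hμ : ContDiffAt ℝ ∞ μ x)
    (h : ∀ y ∈ V, tracefreeRicci g y * (g y)⁻¹ * K y = μ y • K y) :
    ∃ u w : Fin 3 → ℂ,
      (∀ c a, ∑ b, covDerivTwo g x (tracefreeRicci g) c a b * ((g x)⁻¹ * K x) b 0
        = pd c μ x * K x a 0 + K x c 0 * w a) ∧
      (∀ a, w a = μ x * u a - ((tracefreeRicci g x * (g x)⁻¹) *ᵥ u) a) ∧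
      ∑ b, ((g x)⁻¹ * K x) b 0 * u b = 0 ∧ ∑ b, ((g x)⁻¹ * K x) b 0 * w b = 0 := by
  obtain ⟨u, v, huv, hu⟩ := hK.exists_covDerivCov_eq hg hx
  refine ⟨u, _, fun c a => ?_, fun a => rfl, hu, ?_⟩
  · have h1 := covDerivTwo_eigen hg hx (hg.smooth_tracefreeRicci hx) (hK.smooth x hx) hμ h c a
    have h2 : (tracefreeRicci g x * (g x)⁻¹ * covDerivCov g K x c) a 0
        = K x c 0 * ((tracefreeRicci g x * (g x)⁻¹) *ᵥ u) a + v c * (μ x * K x a 0) := by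
      have h3 := congrFun (congrFun (h x hx) a) 0
      rw [Matrix.smul_apply, smul_eq_mul, Matrix.mul_apply] at h3
      rw [← h3, Matrix.mul_apply]
      simp only [huv, Matrix.mulVec, dotProduct, Fin.sum_univ_three]
      ring
    rw [h2, huv] at h1
    linear_combination h1
  · have hΦ : (tracefreeRicci g x)ᵀ = tracefreeRicci g x := by
      ext a b
      exact hg.tracefreeRicci_symm hx b a
    have h1 := congrArg Matrix.transpose (h x hx)
    rw [Matrix.transpose_mul, Matrix.transpose_mul, hg.inv_symm hx, hΦ, Matrix.transpose_smul] at h1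
    -- By symmetry of Φ, k is also a left eigenvector, so k·Φu = μ k·u = 0 and hence k·w = 0.
    have h2 : ((g x)⁻¹ * K x)ᵀ * (tracefreeRicci g x * (g x)⁻¹) = μ x • ((g x)⁻¹ * K x)ᵀ := by
      rw [Matrix.transpose_mul, hg.inv_symm hx, ← Matrix.mul_assoc, Matrix.mul_assoc, Matrix.mul_assoc,
        ← Matrix.mul_assoc (g x)⁻¹, ← Matrix.mul_assoc, h1, Matrix.smul_mul]
    generalize (g x)⁻¹ * K x = k at h2 hu
    generalize tracefreeRicci g x * (g x)⁻¹ = Q at h2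
    have h3 (b : Fin 3) : ∑ a, k a 0 * Q a b = μ x * k b 0 := by
      have := congrFun (congrFun h2 0) b
      simpa [Matrix.mul_apply] using this
    have h0 := h3 0
    have h1 := h3 1
    have h2 := h3 2
    simp only [Fin.sum_univ_three, Matrix.mulVec, dotProduct] at *
    linear_combination -u 0 * h0 - u 1 * h1 - u 2 * h2

/-- The gradient of `S` along a multiple principal null direction. -/
theorem pd_eigenvalue (hg : IsLocalMetric g V) (hx : x ∈ V)
    {μ : R3 → ℂ} (hμ : ContDiffAt ℝ ∞ μ x)
    (h : ∀ y ∈ V, tracefreeRicci g y * (g y)⁻¹ * K y = μ y • K y) :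
    ∑ a, ((g x)⁻¹ * K x) a 0 * pd a μ x = 2 * ∑ a, ((g x)⁻¹ * K x) a 0 * gradS g x a := by
  obtain ⟨u, w, hT, -, -, hw⟩ := hK.exists_covDerivTwo_tracefreeRicci hg hx hμ h
  have hdiv := hg.div_tracefreeRicci hx
  have hk (a : Fin 3) : ∑ d, (g x)⁻¹ a d * K x d 0 = ((g x)⁻¹ * K x) a 0 := rfl
  have hk' (a : Fin 3) : ∑ d, (g x)⁻¹ d a * K x d 0 = ((g x)⁻¹ * K x) a 0 := by
    rw [← hk]
    exact Finset.sum_congr rfl fun d _ => by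
      rw [← congrFun (congrFun (hg.inv_symm hx) a) d, Matrix.transpose_apply]
  generalize (g x)⁻¹ * K x = k at *
  -- Both sides equal k^e∇^aΦ_{ae}: one computed from the differentiated eigenvector equation, where
  -- the w-term drops out, the other from Bianchi.
  calc ∑ a, k a 0 * pd a μ x
      = ∑ a, ∑ d, (g x)⁻¹ a d * (pd a μ x * K x d 0 + K x a 0 * w d) := by
        rw [← add_zero (∑ a, k a 0 * pd a μ x), ← hw]
        simp only [← hk, mul_add, Finset.sum_add_distrib]
        congr 1
        · simp only [Finset.sum_mul]
          exact Finset.sum_congr rfl fun a _ => Finset.sum_congr rfl fun d _ => by ring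
        · simp only [hk]
          rw [Finset.sum_comm]
          refine Finset.sum_congr rfl fun d _ => ?_
          rw [← hk' d, Finset.sum_mul]
          exact Finset.sum_congr rfl fun a _ => by ring
    _ = ∑ e, k e 0 * ∑ a, ∑ d, (g x)⁻¹ a d * covDerivTwo g x (tracefreeRicci g) a e d := by
        have h1 (a d : Fin 3) : pd a μ x * K x d 0 + K x a 0 * w d
            = ∑ e, covDerivTwo g x (tracefreeRicci g) a e d * k e 0 := by
          rw [← hT]
          exact Finset.sum_congr rfl fun e _ => by
            rw [hg.covDerivTwo_tracefreeRicci_symm hx]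
        rw [Finset.sum_congr rfl fun a _ => Finset.sum_congr rfl fun d _ =>
          congrArg ((g x)⁻¹ a d * ·) (h1 a d)]
        simp only [Fin.sum_univ_three]
        ring
    _ = _ := by
        simp only [hdiv, Finset.mul_sum]
        exact Finset.sum_congr rfl fun e _ => by ring

theorem cotton_contract_of_eigen (hg : IsLocalMetric g V) (hx : x ∈ V)
    {μ : R3 → ℂ} (hμ : ContDiffAt ℝ ∞ μ x)
    (h : ∀ y ∈ V, tracefreeRicci g y * (g y)⁻¹ * K y = μ y • K y) (c : Fin 3) :
    ∑ a, ∑ b, ((g x)⁻¹ * K x) a 0 * ((g x)⁻¹ * K x) b 0 *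
      (cotton g x a b c + 3 * g x b c * gradS g x a) = 0 := by
  have hS := hK.pd_eigenvalue hg hx hμ h
  obtain ⟨u, w, hT, -, -, hw⟩ := hK.exists_covDerivTwo_tracefreeRicci hg hx hμ h
  have hkK := hK.dual_null hx
  have hgk (a : Fin 3) : ∑ b, g x a b * ((g x)⁻¹ * K x) b 0 = K x a 0 := by
    rw [← Matrix.mul_apply, ← Matrix.mul_assoc, hg.mul_inv hx, Matrix.one_mul]
  simp only [hg.cotton_eq hx]
  generalize (g x)⁻¹ * K x = k at *
  have e (a b : Fin 3) := hg.apply_symm hx a b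
  -- Every term here carries k·K or k·w; in `h2` only K_c k·∂μ survives.
  have h1 : ∑ a, ∑ b, k a 0 * k b 0 * covDerivTwo g x (tracefreeRicci g) c b a = 0 := by
    have : ∑ b, k b 0 * ∑ a, covDerivTwo g x (tracefreeRicci g) c b a * k a 0 = 0 := by
      simp only [hT, mul_add, Finset.sum_add_distrib, mul_left_comm (k _ 0), ← Finset.mul_sum,
        hkK, hw]
      ring
    rw [← this, Finset.sum_comm]
    simp only [Finset.mul_sum]
    exact Finset.sum_congr rfl fun a _ => Finset.sum_congr rfl fun d _ => by ring
  have h2 : ∑ a, ∑ b, k a 0 * k b 0 * covDerivTwo g x (tracefreeRicci g) b c a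
      = K x c 0 * ∑ a, k a 0 * pd a μ x := by
    have : ∑ b, k b 0 * ∑ a, covDerivTwo g x (tracefreeRicci g) b c a * k a 0
        = K x c 0 * ∑ a, k a 0 * pd a μ x + w c * ∑ b, k b 0 * K x b 0 := by
      simp only [hT, Finset.mul_sum, ← Finset.sum_add_distrib]
      exact Finset.sum_congr rfl fun a _ => by ring
    rw [hkK, mul_zero, add_zero] at this
    rw [← this, Finset.sum_comm]
    simp only [Finset.mul_sum]
    exact Finset.sum_congr rfl fun a _ => Finset.sum_congr rfl fun d _ => by ring
  have g0 := hgk 0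
  have g1 := hgk 1
  have g2 := hgk 2
  have gc := hgk c
  rw [hS] at h2
  simp only [Fin.sum_univ_three, e 1 0, e 2 0, e 2 1, e _ c] at *
  set σ := k 0 0 * gradS g x 0 + k 1 0 * gradS g x 1 + k 2 0 * gradS g x 2
  linear_combination h1 - h2 + 2 * σ * gc + gradS g x c * (k 0 0 * g0 + k 1 0 * g1 + k 2 0 * g2)
    + gradS g x c * hkK

end IsCoGeodeticCovector

end NullGeom

namespace NullGeom

/-! ### Degenerate Petrov types -/

open Matrix

variable {g : R3 → Matrix (Fin 3) (Fin 3) ℂ} {V : Set R3} {x : R3}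
  {i : Fin 3} {K : R3 → Matrix (Fin 3) (Fin 1) ℂ}

namespace IsCoGeodeticCovector

variable (hK : IsCoGeodeticCovector g V i K)
include hK

/-- The eigenvalue is identically zero, so the relation k·∂μ = 2 k·∇S gives the result. -/
theorem gradS_of_kernel (hg : IsLocalMetric g V) (hx : x ∈ V)
    (h : ∀ y ∈ V, tracefreeRicci g y * (g y)⁻¹ * K y = 0) :
    ∑ a, ((g x)⁻¹ * K x) a 0 * gradS g x a = 0 := by
  have h1 := hK.pd_eigenvalue hg hx (μ := fun _ => 0) contDiffAt_const (by simpa using h)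
  simpa [pd_const] using h1.symm

theorem cotton_contract_of_kernel (hg : IsLocalMetric g V) (hx : x ∈ V)
    (h : ∀ y ∈ V, tracefreeRicci g y * (g y)⁻¹ * K y = 0) (c : Fin 3) :
    ∑ a, ∑ b, ((g x)⁻¹ * K x) a 0 * ((g x)⁻¹ * K x) b 0 * cotton g x a b c = 0 := by
  have h1 := hK.cotton_contract_of_eigen hg hx (μ := fun _ => 0) contDiffAt_const
    (by simpa using h) c
  have h2 := hK.gradS_of_kernel hg hx h
  generalize (g x)⁻¹ * K x = k at *
  rw [← h1]
  simp only [mul_add, Finset.sum_add_distrib]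
  rw [left_eq_add, Finset.sum_comm]
  refine Finset.sum_eq_zero fun b _ => ?_
  rw [← mul_zero (k b 0 * (3 * g x b c)), ← h2, Finset.mul_sum]
  exact Finset.sum_congr rfl fun a _ => by ring

/-- The condition `hτ` makes w a multiple of K, so (∇_cΦ_{ba})k^a is a multiple of K_cK_b and
cancels on skewing in b and c. Only the gradient terms of the Cotton tensor remain. -/
theorem cotton_single_of_kernel (hg : IsLocalMetric g V) (hx : x ∈ V)
    (h : ∀ y ∈ V, tracefreeRicci g y * (g y)⁻¹ * K y = 0)
    (hτ : ∀ u : Fin 3 → ℂ, ∑ b, ((g x)⁻¹ * K x) b 0 * u b = 0 →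
      ∃ τ : ℂ, ∀ a, ((tracefreeRicci g x * (g x)⁻¹) *ᵥ u) a = τ * K x a 0) (b c : Fin 3) :
    ∑ a, ((g x)⁻¹ * K x) a 0 * (cotton g x a b c
      - (g x a b * gradS g x c - g x a c * gradS g x b)) = 0 := by
  obtain ⟨u, w, hT, hw, hu, -⟩ := hK.exists_covDerivTwo_tracefreeRicci hg hx (μ := fun _ => 0)
    contDiffAt_const (by simpa using h)
  obtain ⟨τ, hτ⟩ := hτ u hu
  simp only [hτ, zero_mul, zero_sub] at hw
  simp only [hw, pd_const, zero_mul, zero_add] at hT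
  simp only [hg.cotton_eq hx, hg.apply_symm hx b, hg.apply_symm hx c]
  generalize (g x)⁻¹ * K x = k at *
  have h1 := hT c b
  have h2 := hT b c
  simp only [Fin.sum_univ_three] at *
  linear_combination h1 - h2

theorem covDerivTwo_tracefreeRicci_of_square (hg : IsLocalMetric g V) (hx : x ∈ V)
    {φ : R3 → ℂ} (hφ : ContDiffAt ℝ ∞ φ x)
    (h : ∀ y ∈ V, ∀ a b, tracefreeRicci g y a b = φ y * (K y a 0 * K y b 0)) (c a b : Fin 3) :
    covDerivTwo g x (tracefreeRicci g) c a b = pd c φ x * (K x a 0 * K x b 0)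
      + φ x * (covDerivCov g K x c a 0 * K x b 0 + K x a 0 * covDerivCov g K x c b 0) := by
  have sK := hK.smooth x hx
  have h1 : pd c (fun y => tracefreeRicci g y a b) x = pd c φ x * (K x a 0 * K x b 0)
      + φ x * (pd c (fun y => K y a 0) x * K x b 0 + K x a 0 * pd c (fun y => K y b 0) x) := by
    rw [pd_congr c (Filter.mem_of_superset (hg.mem_nhds hx) fun y hy => h y hy a b),
      pd_mul c hφ ((sK a 0).mul (sK b 0)), pd_mul c (sK a 0) (sK b 0)]
  simp only [covDerivTwo, h1, h x hx, covDerivCov, pdMat, connMat, Matrix.sub_apply,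
    Matrix.mul_apply, Matrix.transpose_apply, Matrix.of_apply, Fin.sum_univ_three]
  ring

/-- If the tracefree Ricci tensor is a multiple of the square of a co-geodetic null covector `K`,
then `∇S` and the contraction of `A_{abc}` with `k^c` are determined by the same scalar. -/
theorem exists_gradS_of_square (hg : IsLocalMetric g V) (hx : x ∈ V)
    {φ : R3 → ℂ} (hφ : ContDiffAt ℝ ∞ φ x)
    (h : ∀ y ∈ V, ∀ a b, tracefreeRicci g y a b = φ y * (K y a 0 * K y b 0)) :
    ∃ s : ℂ, (∀ e, gradS g x e = s * K x e 0) ∧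
      ∀ a b, ∑ c, ((g x)⁻¹ * K x) c 0 * covDerivTwo g x (tracefreeRicci g) c b a
        = 2 * s * (K x a 0 * K x b 0) := by
  obtain ⟨u, v, huv, hu⟩ := hK.exists_covDerivCov_eq hg hx
  have hkK := hK.dual_null hx
  have hT := hK.covDerivTwo_tracefreeRicci_of_square hg hx hφ h
  simp only [huv] at hT
  have hdiv := hg.div_tracefreeRicci hx
  simp only [hT] at hdiv ⊢
  have hk (a : Fin 3) : ∑ d, (g x)⁻¹ a d * K x d 0 = ((g x)⁻¹ * K x) a 0 := rfl
  have hk' (a : Fin 3) : ∑ d, (g x)⁻¹ d a * K x d 0 = ((g x)⁻¹ * K x) a 0 := by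
    rw [← hk]
    exact Finset.sum_congr rfl fun d _ => by
      rw [← congrFun (congrFun (hg.inv_symm hx) a) d, Matrix.transpose_apply]
  generalize (g x)⁻¹ * K x = k at *
  have hc (a b : Fin 3) : ∑ c, k c 0 * (pd c φ x * (K x b 0 * K x a 0)
      + φ x * ((K x c 0 * u b + v c * K x b 0) * K x a 0
        + K x b 0 * (K x c 0 * u a + v c * K x a 0)))
      = ((∑ c, k c 0 * pd c φ x) + 2 * φ x * ∑ c, k c 0 * v c) * (K x a 0 * K x b 0) := by
    simp only [Fin.sum_univ_three] at *
    linear_combination φ x * (u b * K x a 0 + u a * K x b 0) * hkK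
  -- The scalar in `hc` is k·∂φ + 2φ k·v. The divergence of φK⊗K is that scalar times K and equals
  -- 2∇S, so s is half of it.
  refine ⟨(1 / 2) * ((∑ c, k c 0 * pd c φ x) + 2 * φ x * ∑ c, k c 0 * v c), fun e => ?_,
    fun a b => by rw [hc]; ring⟩
  have k0 := hk 0
  have k1 := hk 1
  have k2 := hk 2
  have l0 := hk' 0
  have l1 := hk' 1
  have l2 := hk' 2
  have hd := hdiv e
  simp only [Fin.sum_univ_three] at *
  linear_combination (-1 / 2) * hd
    + (1 / 2) * K x e 0 * (pd 0 φ x * k0 + pd 1 φ x * k1 + pd 2 φ x * k2)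
    + φ x * K x e 0 * (v 0 * k0 + v 1 * k1 + v 2 * k2)
    + (1 / 2) * φ x * u e * (K x 0 0 * k0 + K x 1 0 * k1 + K x 2 0 * k2)
    + (1 / 2) * φ x * u e * hkK
    + (1 / 2) * φ x * K x e 0 * (u 0 * l0 + u 1 * l1 + u 2 * l2)
    + (1 / 2) * φ x * K x e 0 * hu

/-- The terms of k^cA_{abc} are 2sK_aK_b from k^c∇_cΦ, zero from k^c∇_bΦ_{ca} because k·K = 0 and
k·∇_bK = 0, and −sK_aK_b from the gradient of S; the total matches K_a∇_bS. -/
theorem cotton_last_of_square (hg : IsLocalMetric g V) (hx : x ∈ V)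
    {φ : R3 → ℂ} (hφ : ContDiffAt ℝ ∞ φ x)
    (h : ∀ y ∈ V, ∀ a b, tracefreeRicci g y a b = φ y * (K y a 0 * K y b 0)) (a b : Fin 3) :
    ∑ c, ((g x)⁻¹ * K x) c 0 * (cotton g x a b c - g x c a * gradS g x b) = 0 := by
  obtain ⟨s, hs, hT⟩ := hK.exists_gradS_of_square hg hx hφ h
  have hT' (c) := hK.covDerivTwo_tracefreeRicci_of_square hg hx hφ h b c a
  have hn := hK.inv_mul_covDerivCov hg hx b
  have hkK := hK.dual_null hx
  have hT1 := hT a b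
  have hgk : ∑ c, g x a c * ((g x)⁻¹ * K x) c 0 = K x a 0 := by
    rw [← Matrix.mul_apply, ← Matrix.mul_assoc, hg.mul_inv hx, Matrix.one_mul]
  simp only [hg.cotton_eq hx, hs, hT', fun c => hg.apply_symm hx c a]
  generalize (g x)⁻¹ * K x = k at *
  simp only [Fin.sum_univ_three] at *
  linear_combination hT1 - 2 * s * K x b 0 * hgk + s * g x a b * hkK
    - (pd b φ x * K x a 0 + φ x * covDerivCov g K x b a 0) * hkK - φ x * K x a 0 * hn

end IsCoGeodeticCovector

end NullGeom

namespace NullGeom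

/-! ### Linear algebra of null frames -/

open Matrix

section Frames

variable {G P : Matrix (Fin 3) (Fin 3) ℂ} {k l n : Fin 3 → ℂ}

/-- The matrix with columns `k`, `l`, `n`. -/
def frameMat (k l n : Fin 3 → ℂ) : Matrix (Fin 3) (Fin 3) ℂ :=
  Matrix.of fun a j => ![k a, l a, n a] j

theorem lower_eq_mulVec (v : Fin 3 → ℂ) : lower G v = G *ᵥ v := rfl

/-- The inverse of the metric in an adapted frame. -/
def frameMetricInv : Matrix (Fin 3) (Fin 3) ℂ := !![0, 1, 0; 1, 0, 0; 0, 0, -2]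

/-- The metric in an adapted frame. -/
noncomputable def frameMetric : Matrix (Fin 3) (Fin 3) ℂ := !![0, 1, 0; 1, 0, 0; 0, 0, -1 / 2]

theorem frameMetricInv_mul : frameMetricInv * frameMetric = 1 := by
  ext i j
  fin_cases i <;> fin_cases j <;>
    simp [frameMetricInv, frameMetric, Matrix.mul_apply, Fin.sum_univ_three]
  norm_num

namespace IsAdaptedFrame

variable (hf : IsAdaptedFrame G k l n) (hG : Gᵀ = G) (hd : G.det ≠ 0)
include hf hG hd

/-- With E the frame matrix and H = `frameMetricInv`, the frame condition reads G = (GE)H(GE)ᵀ =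
G(EHEᵀ)G, and G can be cancelled. Linear independence of k, ℓ, n is thus a consequence of the frame
condition. -/
theorem inv_eq : G⁻¹ = frameMat k l n * frameMetricInv * (frameMat k l n)ᵀ := by
  have h : G * (frameMat k l n * frameMetricInv * (frameMat k l n)ᵀ) * G = G := by
    have h1 : G * (frameMat k l n * frameMetricInv * (frameMat k l n)ᵀ) * G
        = (G * frameMat k l n) * frameMetricInv * (G * frameMat k l n)ᵀ := by
      rw [Matrix.transpose_mul, hG]
      simp only [Matrix.mul_assoc]
    have h2 : G * frameMat k l n = frameMat (lower G k) (lower G l) (lower G n) := by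
      ext a j
      fin_cases j <;> simp [frameMat, lower, Matrix.mul_apply]
    rw [h1, h2]
    ext a b
    rw [hf a b]
    simp [Matrix.mul_apply, Fin.sum_univ_three, frameMat, frameMetricInv]
    ring
  have hu : IsUnit G.det := hd.isUnit
  have h2 : G * (frameMat k l n * frameMetricInv * (frameMat k l n)ᵀ) = 1 := by
    have h3 := congrArg (fun A => A * G⁻¹) h
    simpa only [Matrix.mul_assoc, Matrix.mul_nonsing_inv _ hu, Matrix.mul_one] using h3
  exact Matrix.inv_eq_right_inv h2

theorem transpose_mul_mul : (frameMat k l n)ᵀ * G * frameMat k l n = frameMetric := by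
  have h1 := Matrix.nonsing_inv_mul G hd.isUnit
  rw [hf.inv_eq hG hd] at h1
  have h2 : frameMat k l n * (frameMetricInv * (frameMat k l n)ᵀ * G) = 1 := by
    simpa only [Matrix.mul_assoc] using h1
  have h3 := mul_eq_one_comm.mp h2
  have h4 : frameMetricInv * ((frameMat k l n)ᵀ * G * frameMat k l n) = 1 := by
    simpa only [Matrix.mul_assoc] using h3
  have h5 := mul_eq_one_comm.mp frameMetricInv_mul
  calc (frameMat k l n)ᵀ * G * frameMat k l n
      = frameMetric * frameMetricInv * ((frameMat k l n)ᵀ * G * frameMat k l n) := by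
        rw [h5, Matrix.one_mul]
    _ = frameMetric := by rw [Matrix.mul_assoc, h4, Matrix.mul_one]

theorem isUnit_frameMat : IsUnit (frameMat k l n) := by
  have h1 := Matrix.nonsing_inv_mul G hd.isUnit
  rw [hf.inv_eq hG hd] at h1
  have h2 : frameMat k l n * (frameMetricInv * (frameMat k l n)ᵀ * G) = 1 := by
    simpa only [Matrix.mul_assoc] using h1
  exact IsUnit.of_mul_eq_one _ h2

end IsAdaptedFrame

/-! ### Components in a null frame and the coefficients of the quartic. -/

/-- The components of `P` in a frame. -/
def frameComp (P : Matrix (Fin 3) (Fin 3) ℂ) (k l n : Fin 3 → ℂ) : Matrix (Fin 3) (Fin 3) ℂ :=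
  (frameMat k l n)ᵀ * P * frameMat k l n

theorem frameComp_zero : frameComp 0 k l n = 0 := by simp [frameComp]

theorem transpose_mulVec_mulVec (j : Fin 3) :
    ((frameMat k l n)ᵀ *ᵥ (P *ᵥ k)) j = frameComp P k l n j 0 := by
  have h : frameMat k l n *ᵥ Pi.single 0 1 = k := by
    ext a
    simp [frameMat]
  rw [show P *ᵥ k = P *ᵥ (frameMat k l n *ᵥ Pi.single 0 1) by rw [h], Matrix.mulVec_mulVec,
    Matrix.mulVec_mulVec]
  simp [frameComp]

theorem frameComp_symm (hP : Pᵀ = P) (i j : Fin 3) :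
    frameComp P k l n i j = frameComp P k l n j i := by
  have : (frameComp P k l n)ᵀ = frameComp P k l n := by
    simp [frameComp, hP, Matrix.mul_assoc]
  exact congrFun (congrFun this j) i

/-- The indices 0, 1, 2 stand for k, ℓ, n. The coefficients are the independent frame components,
with Φ_{nn} and Φ_{kℓ} entering only in the z² term. -/
theorem ricciQuartic_eq (hP : Pᵀ = P) :
    ricciQuartic P k l n = Polynomial.C (1 / 2 * frameComp P k l n 0 0)
      + Polynomial.C (2 * frameComp P k l n 0 2) * Polynomial.X
      + Polynomial.C (2 * frameComp P k l n 2 2 + frameComp P k l n 0 1) * Polynomial.X ^ 2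
      + Polynomial.C (2 * frameComp P k l n 1 2) * Polynomial.X ^ 3
      + Polynomial.C (1 / 2 * frameComp P k l n 1 1) * Polynomial.X ^ 4 := by
  have hs (i j : Fin 3) : P i j = P j i := congrFun (congrFun hP j) i
  have e0 : frameComp P k l n 0 0 = ∑ a, ∑ b, P a b * k a * k b := by
    simp [frameComp, frameMat, Matrix.mul_apply, Fin.sum_univ_three]; ring
  have e1 : frameComp P k l n 0 2 = ∑ a, ∑ b, P a b * k a * n b := by
    simp [frameComp, frameMat, Matrix.mul_apply, Fin.sum_univ_three]; ring
  have e2 : frameComp P k l n 2 2 = ∑ a, ∑ b, P a b * n a * n b := by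
    simp [frameComp, frameMat, Matrix.mul_apply, Fin.sum_univ_three]; ring
  have e3 : frameComp P k l n 0 1 = ∑ a, ∑ b, P a b * k a * l b := by
    simp [frameComp, frameMat, Matrix.mul_apply, Fin.sum_univ_three]; ring
  have e4 : frameComp P k l n 1 2 = ∑ a, ∑ b, P a b * l a * n b := by
    simp [frameComp, frameMat, Matrix.mul_apply, Fin.sum_univ_three]; ring
  have e5 : frameComp P k l n 1 1 = ∑ a, ∑ b, P a b * l a * l b := by
    simp [frameComp, frameMat, Matrix.mul_apply, Fin.sum_univ_three]; ring
  rw [e0, e1, e2, e3, e4, e5, ricciQuartic]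
  refine Polynomial.funext fun z => ?_
  simp only [nullVec, Fin.sum_univ_three, hs 1 0, hs 2 0, hs 2 1, Polynomial.eval_add,
    Polynomial.eval_mul, Polynomial.eval_C, Polynomial.eval_X, Polynomial.eval_pow]
  ring

theorem frameComp_eq_zero_of_dvd (hP : Pᵀ = P) {m : ℕ}
    (h : Polynomial.X ^ m ∣ ricciQuartic P k l n) :
    (0 < m → frameComp P k l n 0 0 = 0) ∧ (1 < m → frameComp P k l n 0 2 = 0) ∧
      (2 < m → 2 * frameComp P k l n 2 2 + frameComp P k l n 0 1 = 0) ∧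
      (3 < m → frameComp P k l n 1 2 = 0) := by
  rw [Polynomial.X_pow_dvd_iff, ricciQuartic_eq hP] at h
  refine ⟨fun hm => ?_, fun hm => ?_, fun hm => ?_, fun hm => ?_⟩ <;>
  · have := h _ hm
    simp only [Polynomial.coeff_add, Polynomial.coeff_C_mul, Polynomial.coeff_X_pow,
      Polynomial.coeff_X, Polynomial.coeff_C] at this
    simpa using this

section Algebra

variable (hG : Gᵀ = G) (hd : G.det ≠ 0) (hP : Pᵀ = P) (htr : (G⁻¹ * P).trace = 0)
include hG hd hP htr

/-- In the frame the trace is 2Φ_{kℓ} − 2Φ_{nn}. -/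
theorem IsAdaptedFrame.frameComp_trace (hf : IsAdaptedFrame G k l n) :
    frameComp P k l n 2 2 = frameComp P k l n 0 1 := by
  rw [hf.inv_eq hG hd, Matrix.mul_assoc, Matrix.trace_mul_comm, ← Matrix.mul_assoc,
    ← frameComp] at htr
  have h := frameComp_symm (k := k) (l := l) (n := n) hP 1 0
  simp [Matrix.trace, Fin.sum_univ_three, Matrix.mul_apply, frameMetricInv, h] at htr
  linear_combination (-1 / 2) * htr

end Algebra

section Cancel

variable (hf : IsAdaptedFrame G k l n) (hG : Gᵀ = G) (hd : G.det ≠ 0)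
include hf hG hd

theorem IsAdaptedFrame.eq_of_mulVec {v w : Fin 3 → ℂ}
    (h : (frameMat k l n)ᵀ *ᵥ v = (frameMat k l n)ᵀ *ᵥ w) : v = w :=
  Matrix.mulVec_injective_of_isUnit
    ((Matrix.isUnit_transpose _).mpr (hf.isUnit_frameMat hG hd)) h

theorem IsAdaptedFrame.eq_of_frameComp {A B : Matrix (Fin 3) (Fin 3) ℂ}
    (h : frameComp A k l n = frameComp B k l n) : A = B := by
  have hu := hf.isUnit_frameMat hG hd
  have hut := (Matrix.isUnit_transpose _).mpr hu
  exact hut.mul_left_cancel (hu.mul_right_cancel h)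

theorem IsAdaptedFrame.frameComp_mul (A B : Matrix (Fin 3) (Fin 3) ℂ) :
    frameComp (A * G⁻¹ * B) k l n
      = frameComp A k l n * frameMetricInv * frameComp B k l n := by
  rw [hf.inv_eq hG hd]
  simp only [frameComp, Matrix.mul_assoc]

theorem IsAdaptedFrame.transpose_mulVec_lower :
    (frameMat k l n)ᵀ *ᵥ lower G k = ![0, 1, 0] := by
  ext j
  rw [lower_eq_mulVec, transpose_mulVec_mulVec, frameComp, hf.transpose_mul_mul hG hd]
  fin_cases j <;> simp [frameMetric]

end Cancel

/-! ### Multiple roots as eigenvectors, degenerate types as nilpotency. -/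

variable (hG : Gᵀ = G) (hd : G.det ≠ 0) (hP : Pᵀ = P)
include hG hd hP

/-- A multiple principal null vector is an eigenvector of the tracefree Ricci tensor. -/
theorem RootMultGE.exists_eigen (h : RootMultGE G P 2 k) :
    lower G k ≠ 0 ∧ ∃ c : ℂ, P *ᵥ k = c • lower G k := by
  obtain ⟨l, n, hf, hdvd⟩ := h
  obtain ⟨h0, h1, -, -⟩ := frameComp_eq_zero_of_dvd hP hdvd
  have hl := hf.transpose_mulVec_lower hG hd
  refine ⟨fun h => ?_, frameComp P k l n 0 1, ?_⟩
  · rw [h, Matrix.mulVec_zero] at hl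
    simpa using congrFun hl 1
  · apply hf.eq_of_mulVec hG hd
    rw [Matrix.mulVec_smul, hl]
    ext j
    fin_cases j
    · simp [transpose_mulVec_mulVec, h0]
    · simp [transpose_mulVec_mulVec, frameComp_symm hP 1 0]
    · simp [transpose_mulVec_mulVec, frameComp_symm hP 2 0, h1]

variable (htr : (G⁻¹ * P).trace = 0)
include htr

/-- The z² coefficient gives 2Φ_{nn} + Φ_{kℓ} = 0 and tracefreeness gives Φ_{nn} = Φ_{kℓ}, so both
vanish. Only Φ_{ℓn} and Φ_{ℓℓ} survive, and Φ moves strictly down the flag N ⊂ N^⊥. The conclusion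
does not mention k, so it can be used at another null line. -/
theorem RootMultGE.nilpotent_three (h : RootMultGE G P 3 k) :
    P * G⁻¹ * P * G⁻¹ * P = 0 := by
  obtain ⟨l, n, hf, hdvd⟩ := h
  obtain ⟨h0, h1, h2, -⟩ := frameComp_eq_zero_of_dvd hP hdvd
  have ht := hf.frameComp_trace hG hd hP htr
  have h3 : frameComp P k l n 0 1 = 0 := by
    linear_combination (1 / 3) * h2 (by norm_num) - (2 / 3) * ht
  apply hf.eq_of_frameComp hG hd
  rw [hf.frameComp_mul hG hd, hf.frameComp_mul hG hd]
  ext i j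
  have s := frameComp_symm (k := k) (l := l) (n := n) hP
  fin_cases i <;> fin_cases j <;>
    simp [frameComp_zero, Matrix.mul_apply, Fin.sum_univ_three, frameMetricInv, s 1 0, s 2 0, s 2 1,
      ht, h3, h0, h1]

theorem RootMultGE.nilpotent_two (h : RootMultGE G P 4 k) : P * G⁻¹ * P = 0 := by
  obtain ⟨l, n, hf, hdvd⟩ := h
  obtain ⟨h0, h1, h2, h4⟩ := frameComp_eq_zero_of_dvd hP hdvd
  have ht := hf.frameComp_trace hG hd hP htr
  have h3 : frameComp P k l n 0 1 = 0 := by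
    linear_combination (1 / 3) * h2 (by norm_num) - (2 / 3) * ht
  apply hf.eq_of_frameComp hG hd
  rw [hf.frameComp_mul hG hd]
  ext i j
  have s := frameComp_symm (k := k) (l := l) (n := n) hP
  fin_cases i <;> fin_cases j <;>
    simp [frameComp_zero, Matrix.mul_apply, Fin.sum_univ_three, frameMetricInv, s 1 0, s 2 0, s 2 1,
      ht, h3, h0, h1, h4]

/-- The double root makes k an eigenvector and nilpotency makes its eigenvalue zero. Tracefreeness
then kills Φ_{nn}, so on N^⊥ only Φ_{ℓn} contributes, and it lands in the line of the lowered k. -/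
theorem RootMultGE.of_nilpotent_three (h : RootMultGE G P 2 k)
    (hN : P * G⁻¹ * P * G⁻¹ * P = 0) :
    P *ᵥ k = 0 ∧ ∀ u : Fin 3 → ℂ, k ⬝ᵥ u = 0 → ∃ τ : ℂ, (P * G⁻¹) *ᵥ u = τ • lower G k := by
  obtain ⟨hne, c, hc⟩ := h.exists_eigen hG hd hP
  have hk : G⁻¹ *ᵥ lower G k = k := by
    rw [lower_eq_mulVec, Matrix.mulVec_mulVec, Matrix.nonsing_inv_mul G hd.isUnit,
      Matrix.one_mulVec]
  have hc0 : c = 0 := by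
    have h1 := congrArg (fun A => A *ᵥ k) hN
    simp only [← Matrix.mulVec_mulVec, hc, Matrix.mulVec_smul, hk, Matrix.zero_mulVec,
      smul_smul] at h1
    simpa [hne] using h1
  obtain ⟨l, n, hf, hdvd⟩ := h
  obtain ⟨h0, h1, -, -⟩ := frameComp_eq_zero_of_dvd hP hdvd
  have hl := hf.transpose_mulVec_lower hG hd
  rw [hc0, zero_smul] at hc
  refine ⟨hc, fun u hu => ?_⟩
  have s := frameComp_symm (k := k) (l := l) (n := n) hP
  have ht := hf.frameComp_trace hG hd hP htr
  have h3 : frameComp P k l n 0 1 = 0 := by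
    rw [s, ← transpose_mulVec_mulVec, hc, Matrix.mulVec_zero, Pi.zero_apply]
  -- The factor −2 is the nn entry of the inverse frame metric.
  refine ⟨frameComp P k l n 1 2 * (-2 * (n ⬝ᵥ u)), hf.eq_of_mulVec hG hd ?_⟩
  rw [Matrix.mulVec_smul, hl, hf.inv_eq hG hd, Matrix.mulVec_mulVec, ← Matrix.mul_assoc,
    ← Matrix.mul_assoc, ← Matrix.mul_assoc, ← frameComp, ← Matrix.mulVec_mulVec]
  have hEu : (frameMat k l n)ᵀ *ᵥ u = ![0, l ⬝ᵥ u, n ⬝ᵥ u] := by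
    rw [← hu]
    ext j
    fin_cases j <;> rfl
  rw [hEu]
  ext j
  fin_cases j <;>
    simp [Matrix.mulVec, dotProduct, Matrix.mul_apply, Fin.sum_univ_three, frameMetricInv, s 1 0,
      s 2 0, s 2 1, ht, h3, h0, h1]
  ring

theorem RootMultGE.of_nilpotent_two (h : RootMultGE G P 2 k) (hN : P * G⁻¹ * P = 0) :
    ∃ φ : ℂ, ∀ a b, P a b = φ * (lower G k a * lower G k b) := by
  have hN3 : P * G⁻¹ * P * G⁻¹ * P = 0 := by rw [hN, Matrix.zero_mul, Matrix.zero_mul]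
  obtain ⟨hc, -⟩ := h.of_nilpotent_three hG hd hP htr hN3
  obtain ⟨l, n, hf, hdvd⟩ := h
  obtain ⟨h0, h1, -, -⟩ := frameComp_eq_zero_of_dvd hP hdvd
  have hl := hf.transpose_mulVec_lower hG hd
  have s := frameComp_symm (k := k) (l := l) (n := n) hP
  have ht := hf.frameComp_trace hG hd hP htr
  have h3 : frameComp P k l n 0 1 = 0 := by
    rw [s, ← transpose_mulVec_mulVec, hc, Matrix.mulVec_zero, Pi.zero_apply]
  -- The ℓℓ component of Φ² is −2Φ_{ℓn}² once Φ_{kℓ} = 0.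
  have h4 : frameComp P k l n 1 2 = 0 := by
    have h5 := hf.frameComp_mul hG hd P P
    rw [hN] at h5
    have h6 := congrFun (congrFun h5 1) 1
    simpa [frameComp_zero, Matrix.mul_apply, Fin.sum_univ_three, frameMetricInv, s 1 0, s 2 0,
      s 2 1, ht, h3, h0, h1] using h6
  refine ⟨frameComp P k l n 1 1, ?_⟩
  have h7 : P = frameComp P k l n 1 1 • Matrix.vecMulVec (lower G k) (lower G k) := by
    apply hf.eq_of_frameComp hG hd
    have h8 : frameComp (frameComp P k l n 1 1 • Matrix.vecMulVec (lower G k) (lower G k)) k l n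
        = frameComp P k l n 1 1 • Matrix.vecMulVec ![0, 1, 0] ![0, 1, 0] := by
      rw [frameComp, Matrix.mul_smul, Matrix.smul_mul, Matrix.mul_vecMulVec, Matrix.vecMulVec_mul,
        ← Matrix.mulVec_transpose, hl]
    rw [h8]
    ext i j
    fin_cases i <;> fin_cases j <;>
      simp [Matrix.vecMulVec, s 1 0, s 2 0, s 2 1, ht, h3, h0, h1, h4]
  intro a b
  have h9 := congrFun (congrFun h7 a) b
  simpa [Matrix.vecMulVec] using h9

theorem HasPetrovType.nilpotent_three {T : PetrovType}
    (hT : T ∈ ({.typeIII, .typeN, .typeO} : Set PetrovType)) (h : HasPetrovType G P T) :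
    P * G⁻¹ * P * G⁻¹ * P = 0 := by
  rcases hT with rfl | rfl | rfl
  · obtain ⟨k, hk, -⟩ := h
    exact hk.nilpotent_three hG hd hP htr
  · obtain ⟨k, hk, -⟩ := h
    rw [hk.nilpotent_two hG hd hP htr, Matrix.zero_mul, Matrix.zero_mul]
  · have h' : P = 0 := h
    simp [h']

theorem HasPetrovType.nilpotent_two {T : PetrovType}
    (hT : T ∈ ({.typeN, .typeO} : Set PetrovType)) (h : HasPetrovType G P T) :
    P * G⁻¹ * P = 0 := by
  rcases hT with rfl | rfl
  · obtain ⟨k, hk, -⟩ := h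
    exact hk.nilpotent_two hG hd hP htr
  · have h' : P = 0 := h
    simp [h']

end Frames

end NullGeom

namespace NullGeom

/-! ### Coordinate vectors on a manifold -/

open Matrix

section Manifold

variable {M : Type*} [TopologicalSpace M] [ChartedSpace R3 M]

/-- The differential of the inverse chart is a real linear isomorphism; base change turns the image
of the standard basis into a complex basis. -/
theorem vec_bijective [IsManifold (𝓡 3) ∞ M] {e : OpenPartialHomeomorph M R3}
    (he : e ∈ IsManifold.maximalAtlas (𝓡 3) ∞ M) {x : R3} (hx : x ∈ e.target) :
    Function.Bijective (vec e x) := by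
  have hm : e.MDifferentiable (𝓡 3) (𝓡 3) :=
    ⟨(contMDiffOn_of_mem_maximalAtlas he).mdifferentiableOn (by simp),
      (contMDiffOn_symm_of_mem_maximalAtlas he).mdifferentiableOn (by simp)⟩
  let A : R3 ≃ₗ[ℝ] TangentSpace (𝓡 3) (e.symm x) := (hm.symm.mfderiv hx).toLinearEquiv
  let b : Module.Basis (Fin 3) ℝ (TangentSpace (𝓡 3) (e.symm x)) :=
    (EuclideanSpace.basisFun (Fin 3) ℝ).toBasis.map A
  let B : Module.Basis (Fin 3) ℂ (TC (e.symm x)) := Algebra.TensorProduct.basis ℂ b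
  have h : vec e x = B.equivFun.symm := by
    funext v
    rw [Module.Basis.equivFun_symm_apply, vec]
    refine Finset.sum_congr rfl fun i _ => ?_
    rw [Algebra.TensorProduct.basis_apply, TensorProduct.smul_tmul', smul_eq_mul, mul_one]
    congr 1
    simp only [b, Module.Basis.map_apply, OrthonormalBasis.coe_toBasis,
      EuclideanSpace.basisFun_apply]
    rfl
  rw [h]
  exact B.equivFun.symm.bijective

theorem vec_smul (e : OpenPartialHomeomorph M R3) (x : R3) (c : ℂ) (v : Fin 3 → ℂ) :
    vec e x (c • v) = c • vec e x v := by
  simp only [vec, Pi.smul_apply, Finset.smul_sum, TensorProduct.smul_tmul']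

theorem form_vec (b : ∀ p : M, LinearMap.BilinForm ℂ (TC p)) (e : OpenPartialHomeomorph M R3)
    (x : R3) (v w : Fin 3 → ℂ) :
    b (e.symm x) (vec e x v) (vec e x w) = ∑ i, ∑ j, v i * w j * comps b e x i j := by
  have h (v : Fin 3 → ℂ) : vec e x v = ∑ i, v i • vec e x (Pi.single i 1) := by
    have hs : ∀ i : Fin 3, vec e x (Pi.single i 1) = (1 : ℂ) ⊗ₜ[ℝ]
        (mfderiv (𝓡 3) (𝓡 3) e.symm x (EuclideanSpace.single i (1 : ℝ))) := fun i => by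
      rw [vec, Finset.sum_eq_single i]
      · simp
      · intro j _ hj
        simp [hj]
      · simp
    rw [vec]
    exact Finset.sum_congr rfl fun i _ => by
      rw [hs, TensorProduct.smul_tmul', smul_eq_mul, mul_one]
  rw [h v, h w]
  simp only [map_sum, map_smul, LinearMap.sum_apply, LinearMap.smul_apply, smul_eq_mul, comps,
    Matrix.of_apply, Finset.mul_sum]
  rw [Finset.sum_comm]
  exact Finset.sum_congr rfl fun i _ => Finset.sum_congr rfl fun j _ => by ring

theorem form_vec_eq_lower (g : ComplexMetric M) (e : OpenPartialHomeomorph M R3)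
    (x : R3) (v w : Fin 3 → ℂ) :
    g.form (e.symm x) (vec e x v) (vec e x w) = ∑ i, v i * lower (comps g.form e x) w i := by
  simp only [form_vec, lower, Finset.mul_sum]
  exact Finset.sum_congr rfl fun i _ => Finset.sum_congr rfl fun j _ => by ring

theorem IsLocalMetric.mono {g : R3 → Matrix (Fin 3) (Fin 3) ℂ} {V W : Set R3}
    (hg : IsLocalMetric g W) (hV : IsOpen V) (h : V ⊆ W) : IsLocalMetric g V :=
  ⟨hV, fun x hx => hg.smooth x (h hx), fun x hx => hg.symm x (h hx),
    fun x hx => hg.det_ne x (h hx)⟩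

theorem ComplexMetric.isLocalMetric [IsManifold (𝓡 3) ∞ M] (g : ComplexMetric M)
    {e : OpenPartialHomeomorph M R3} (he : e ∈ IsManifold.maximalAtlas (𝓡 3) ∞ M) :
    IsLocalMetric (comps g.form e) e.target := by
  refine ⟨e.open_target, fun x hx i j => (g.smooth e he i j).contDiffAt
    (e.open_target.mem_nhds hx), fun x hx => ?_, fun x hx h => ?_⟩
  · ext i j
    exact g.symm _ _ _
  · obtain ⟨v, hv, h0⟩ := Matrix.exists_mulVec_eq_zero_iff.mpr h
    have hb := vec_bijective he hx
    refine hv (hb.1 ?_)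
    have hz : vec e x 0 = 0 := by simp [vec]
    rw [hz]
    refine g.nondegenerate _ _ fun w => ?_
    obtain ⟨w, rfl⟩ := hb.2 w
    rw [g.symm, form_vec_eq_lower, lower_eq_mulVec, h0]
    simp

/-- Near any point a co-geodetic null structure is generated by a normalised co-geodetic null
covector. -/
theorem NullStructure.exists_isCoGeodeticCovector [IsManifold (𝓡 3) ∞ M] {g : ComplexMetric M}
    (N : NullStructure g) (hgeo : N.IsCoGeodetic) {e : OpenPartialHomeomorph M R3}
    (he : e ∈ IsManifold.maximalAtlas (𝓡 3) ∞ M) {x : R3} (hx : x ∈ e.target) :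
    ∃ (V : Set R3) (i : Fin 3) (K : R3 → Matrix (Fin 3) (Fin 1) ℂ), x ∈ V ∧ V ⊆ e.target ∧
      IsLocalMetric (comps g.form e) V ∧ IsCoGeodeticCovector (comps g.form e) V i K ∧
      ∀ y ∈ V, N.line (e.symm y) =
        Submodule.span ℂ {vec e y fun b => ((comps g.form e y)⁻¹ * K y) b 0} := by
  obtain ⟨W, hW, hxW, hWe, k, hk, hline⟩ := N.smooth e he x hx
  have hgW := (g.isLocalMetric he).mono hW hWe
  have hkW (y) (hy : y ∈ W) (b) : ContDiffAt ℝ ∞ (fun y => k y b) y :=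
    contDiffAt_pi.mp (hk.contDiffAt (hW.mem_nhds hy)) b
  have sL (y) (hy : y ∈ W) (a) : ContDiffAt ℝ ∞ (fun y => lower (comps g.form e y) (k y) a) y :=
    ContDiffAt.sum fun b _ => (hgW.smooth y hy a b).mul (hkW y hy b)
  have hdual (y) (hy : y ∈ W) : (comps g.form e y)⁻¹ *ᵥ lower (comps g.form e y) (k y) = k y := by
    rw [lower_eq_mulVec, Matrix.mulVec_mulVec, hgW.inv_mul hy, Matrix.one_mulVec]
  have hLx : lower (comps g.form e x) (k x) ≠ 0 := by
    intro h0
    have h1 := hdual x hxW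
    rw [h0, Matrix.mulVec_zero] at h1
    have h2 := N.finrank_line (e.symm x)
    have hz : vec e x 0 = 0 := by simp [vec]
    rw [hline x hxW, ← h1, hz, Submodule.span_zero_singleton, finrank_bot] at h2
    exact zero_ne_one h2
  obtain ⟨i, hi⟩ := Function.ne_iff.mp hLx
  have hcont : ContinuousOn (fun y => lower (comps g.form e y) (k y) i) W :=
    fun y hy => (sL y hy i).continuousAt.continuousWithinAt
  -- Shrinking to where the i-th lowered component is nonzero permits division by it.
  let V : Set R3 := W ∩ (fun y => lower (comps g.form e y) (k y) i) ⁻¹' {0}ᶜ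
  have hV : IsOpen V := hcont.isOpen_inter_preimage hW isOpen_compl_singleton
  have hne (y) (hy : y ∈ V) : lower (comps g.form e y) (k y) i ≠ 0 := hy.2
  let K : R3 → Matrix (Fin 3) (Fin 1) ℂ := fun y => Matrix.of fun a _ =>
    (lower (comps g.form e y) (k y) i)⁻¹ * lower (comps g.form e y) (k y) a
  have sK (y) (hy : y ∈ V) : MatSmoothAt K y := fun a _ =>
    ((sL y hy.1 i).inv (hne y hy)).mul (sL y hy.1 a)
  have hgV := hgW.mono hV Set.inter_subset_left
  have hnorm (y) (hy : y ∈ V) : K y i 0 = 1 := inv_mul_cancel₀ (hne y hy)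
  have hHK (y) (hy : y ∈ V) : (fun b => ((comps g.form e y)⁻¹ * K y) b 0)
      = (lower (comps g.form e y) (k y) i)⁻¹ • k y := by
    rw [show (lower (comps g.form e y) (k y) i)⁻¹ • k y = (lower (comps g.form e y) (k y) i)⁻¹ •
      (comps g.form e y)⁻¹ *ᵥ lower (comps g.form e y) (k y) by rw [hdual y hy.1]]
    ext b
    simp only [Matrix.mul_apply, K, Matrix.of_apply, Pi.smul_apply, Matrix.mulVec, dotProduct,
      smul_eq_mul, Finset.mul_sum]
    exact Finset.sum_congr rfl fun a _ => by ring
  have hspan (y) (hy : y ∈ V) : N.line (e.symm y) =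
      Submodule.span ℂ {vec e y fun b => ((comps g.form e y)⁻¹ * K y) b 0} := by
    rw [hHK y hy, vec_smul, Submodule.span_singleton_smul_eq (inv_ne_zero (hne y hy)).isUnit]
    exact hline y hy.1
  have hlow (y) (hy : y ∈ V) (a) :
      lower (comps g.form e y) (fun b => ((comps g.form e y)⁻¹ * K y) b 0) a = K y a 0 := by
    simp only [lower]
    rw [← Matrix.mul_apply, ← Matrix.mul_assoc, hgV.mul_inv hy, Matrix.one_mul]
  have hmem (y) (hy : y ∈ V) :
      vec e y (fun b => ((comps g.form e y)⁻¹ * K y) b 0) ∈ N.line (e.symm y) := by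
    rw [hspan y hy]
    exact Submodule.mem_span_singleton_self _
  have sAnn (a) : ContDiffOn ℝ ∞ (annField K i a) V := fun y hy => by
    refine (contDiffAt_pi.mpr fun c => ?_).contDiffWithinAt
    exact contDiffAt_const.sub ((sK y hy a 0).mul contDiffAt_const)
  have hperp (a) (y) (hy : y ∈ V) : N.InPerp (e.symm y) (vec e y (annField K i a y)) := by
    intro m hm
    rw [hspan y hy, Submodule.mem_span_singleton] at hm
    obtain ⟨c, rfl⟩ := hm
    rw [map_smul, form_vec_eq_lower]
    simp only [hlow y hy, annField, sub_mul, Finset.sum_sub_distrib, mul_assoc, ← Finset.mul_sum,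
      Pi.single_apply, ite_mul, one_mul, zero_mul, Finset.sum_ite_eq', Finset.mem_univ, if_true,
      hnorm y hy]
    simp
  refine ⟨V, i, K, ⟨hxW, hi⟩, fun y hy => hWe hy.1, hgV, ⟨sK, hnorm, fun y hy => ?_, ?_⟩, hspan⟩
  · have h := N.null _ _ (hmem y hy)
    rw [form_vec_eq_lower] at h
    simp only [hlow y hy] at h
    ext p q
    rw [Fin.fin_one_eq_zero p, Fin.fin_one_eq_zero q, Matrix.mul_assoc, Matrix.mul_apply,
      Matrix.zero_apply, ← h]
    exact Finset.sum_congr rfl fun b _ => mul_comm _ _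
  · intro y hy a b
    have h := hgeo e he V hV (fun y hy => hWe hy.1) (annField K i a) (annField K i b)
      (fun y b => ((comps g.form e y)⁻¹ * K y) b 0) (sAnn a) (sAnn b)
      (fun y hy => (contDiffAt_pi.mpr fun c =>
        (hgV.smooth_inv hy).mul (sK y hy) c 0).contDiffWithinAt)
      (hperp a) (hperp b) hmem y hy
    rw [← h]
    refine Finset.sum_congr rfl fun c _ => ?_
    rw [← hlow y hy c, lower, Finset.mul_sum]
    exact Finset.sum_congr rfl fun d _ => by ring

end Manifold

end NullGeom

namespace NullGeom

/-! ### Null structures and the algebraic type of the tracefree Ricci tensor -/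

open Matrix

section Manifold

variable {M : Type*} [TopologicalSpace M] [ChartedSpace R3 M] [IsManifold (𝓡 3) ∞ M]
  {g : ComplexMetric M} {N : NullStructure g} {e : OpenPartialHomeomorph M R3}
  (he : e ∈ IsManifold.maximalAtlas (𝓡 3) ∞ M) {V : Set R3} {i : Fin 3}
  {K : R3 → Matrix (Fin 3) (Fin 1) ℂ}
include he

theorem exists_smul_of_vec_mem_line {y : R3} (hy : y ∈ e.target) {k k' : Fin 3 → ℂ}
    (hl : N.line (e.symm y) = Submodule.span ℂ {vec e y k'})
    (hk : vec e y k ∈ N.line (e.symm y)) : ∃ c : ℂ, k = c • k' := by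
  rw [hl, Submodule.mem_span_singleton] at hk
  obtain ⟨c, hc⟩ := hk
  refine ⟨c, (vec_bijective he hy).1 ?_⟩
  rw [vec_smul, hc]

variable (hVe : V ⊆ e.target) (hg : IsLocalMetric (comps g.form e) V)
  (hK : IsCoGeodeticCovector (comps g.form e) V i K)
  (hline : ∀ y ∈ V, N.line (e.symm y) =
    Submodule.span ℂ {vec e y fun b => ((comps g.form e y)⁻¹ * K y) b 0})
  (hmult : N.IsMultiplePrincipal)
include hVe hg hline hmult

/-- The vector supplied by the multiple principal condition depends on the point without regularity,
so it is compared with the smooth generator; the factor is nonzero because the lowered vector is. -/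
theorem exists_rootMultGE {y : R3} (hy : y ∈ V) :
    ∃ c : ℂ, c ≠ 0 ∧
      lower (comps g.form e y) (c • fun b => ((comps g.form e y)⁻¹ * K y) b 0)
        = c • (fun b => K y b 0) ∧
      RootMultGE (comps g.form e y) (tracefreeRicci (comps g.form e) y) 2
        (c • fun b => ((comps g.form e y)⁻¹ * K y) b 0) := by
  obtain ⟨k, hk, hroot⟩ := hmult e he y (hVe hy)
  obtain ⟨c, rfl⟩ := exists_smul_of_vec_mem_line he (hVe hy) (hline y hy) hk
  have hP : (tracefreeRicci (comps g.form e) y)ᵀ = tracefreeRicci (comps g.form e) y := by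
    ext a b
    exact hg.tracefreeRicci_symm hy b a
  obtain ⟨hne, -⟩ := hroot.exists_eigen (hg.symm y hy) (hg.det_ne y hy) hP
  refine ⟨c, fun h => hne ?_, ?_, hroot⟩
  · rw [h, zero_smul, lower_eq_mulVec, Matrix.mulVec_zero]
  · rw [lower_eq_mulVec, Matrix.mulVec_smul]
    congr 1
    ext a
    change (comps g.form e y * ((comps g.form e y)⁻¹ * K y)) a 0 = K y a 0
    rw [← Matrix.mul_assoc, hg.mul_inv hy, Matrix.one_mul]

include hK in
-- The normalisation K_i = 1 reads the eigenvalue off as the i-th component of Φk. This exhibits it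
-- as a smooth function of the point, which can then be differentiated.
theorem tracefreeRicci_eigen {y : R3} (hy : y ∈ V) :
    tracefreeRicci (comps g.form e) y * (comps g.form e y)⁻¹ * K y
      = (tracefreeRicci (comps g.form e) y * (comps g.form e y)⁻¹ * K y) i 0 • K y := by
  obtain ⟨c, hc, hlow, hroot⟩ := exists_rootMultGE he hVe hg hline hmult hy
  have hP : (tracefreeRicci (comps g.form e) y)ᵀ = tracefreeRicci (comps g.form e) y := by
    ext a b
    exact hg.tracefreeRicci_symm hy b a
  obtain ⟨-, μ, hμ⟩ := hroot.exists_eigen (hg.symm y hy) (hg.det_ne y hy) hP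
  rw [hlow, Matrix.mulVec_smul, smul_comm μ c] at hμ
  have h1 := smul_right_injective (Fin 3 → ℂ) hc hμ
  have h2 : tracefreeRicci (comps g.form e) y * (comps g.form e y)⁻¹ * K y = μ • K y := by
    ext a j
    rw [Fin.fin_one_eq_zero j, Matrix.mul_assoc]
    exact congrFun h1 a
  rw [h2, Matrix.smul_apply, hK.norm y hy, smul_eq_mul, mul_one]

/-- Nilpotency transfers the degeneracy from the null line named by the Petrov type to N. -/
theorem tracefreeRicci_kernel {y : R3} (hy : y ∈ V) {T : PetrovType}
    (hT : T ∈ ({.typeIII, .typeN, .typeO} : Set PetrovType))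
    (h : g.HasPetrovTypeAt (e.symm y) T) :
    tracefreeRicci (comps g.form e) y * (comps g.form e y)⁻¹ * K y = 0 ∧
      ∀ u : Fin 3 → ℂ, ∑ b, ((comps g.form e y)⁻¹ * K y) b 0 * u b = 0 →
        ∃ τ : ℂ, ∀ a, ((tracefreeRicci (comps g.form e) y * (comps g.form e y)⁻¹) *ᵥ u) a
          = τ * K y a 0 := by
  obtain ⟨c, hc, hlow, hroot⟩ := exists_rootMultGE he hVe hg hline hmult hy
  have hP : (tracefreeRicci (comps g.form e) y)ᵀ = tracefreeRicci (comps g.form e) y := by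
    ext a b
    exact hg.tracefreeRicci_symm hy b a
  have hT' := h e he (e.map_target (hVe hy))
  rw [e.right_inv (hVe hy)] at hT'
  have htr := hg.trace_inv_mul_tracefreeRicci hy
  have hN := hT'.nilpotent_three (hg.symm y hy) (hg.det_ne y hy) hP htr hT
  obtain ⟨h1, h2⟩ := hroot.of_nilpotent_three (hg.symm y hy) (hg.det_ne y hy) hP htr hN
  rw [Matrix.mulVec_smul, smul_eq_zero_iff_right hc] at h1
  refine ⟨?_, fun u hu => ?_⟩
  · ext a j
    rw [Fin.fin_one_eq_zero j, Matrix.mul_assoc]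
    exact congrFun h1 a
  · obtain ⟨τ, hτ⟩ := h2 u (by
      rw [smul_dotProduct, smul_eq_zero_iff_right hc]
      exact hu)
    refine ⟨τ * c, fun a => ?_⟩
    rw [hτ, hlow]
    simp only [Pi.smul_apply, smul_eq_mul, mul_assoc]

include hK in
-- As for the eigenvalue, K_i = 1 identifies the coefficient with the smooth component Φ_{ii}.
theorem tracefreeRicci_square {y : R3} (hy : y ∈ V) {T : PetrovType}
    (hT : T ∈ ({.typeN, .typeO} : Set PetrovType))
    (h : g.HasPetrovTypeAt (e.symm y) T) (a b : Fin 3) :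
    tracefreeRicci (comps g.form e) y a b
      = tracefreeRicci (comps g.form e) y i i * (K y a 0 * K y b 0) := by
  obtain ⟨c, hc, hlow, hroot⟩ := exists_rootMultGE he hVe hg hline hmult hy
  have hP : (tracefreeRicci (comps g.form e) y)ᵀ = tracefreeRicci (comps g.form e) y := by
    ext a b
    exact hg.tracefreeRicci_symm hy b a
  have hT' := h e he (e.map_target (hVe hy))
  rw [e.right_inv (hVe hy)] at hT'
  have htr := hg.trace_inv_mul_tracefreeRicci hy
  have hN := hT'.nilpotent_two (hg.symm y hy) (hg.det_ne y hy) hP htr hT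
  obtain ⟨φ, hφ⟩ := hroot.of_nilpotent_two (hg.symm y hy) (hg.det_ne y hy) hP htr hN
  simp only [hφ, hlow, Pi.smul_apply, smul_eq_mul, hK.norm y hy]
  ring

end Manifold

end NullGeom

/-! ### The three Petrov cases. -/

open NullGeom in
theorem mainTheorem9 {M : Type*} [TopologicalSpace M] [ChartedSpace R3 M]
    [IsManifold (𝓡 3) ∞ M] (g : ComplexMetric M) (N : NullStructure g)
    (hgeo : N.IsCoGeodetic) (hmult : N.IsMultiplePrincipal) :
    -- Petrov type II, possibly degenerating further
    ((∀ p, ∃ T ∈ ({.typeII, .typeD, .typeIII, .typeN, .typeO} : Set PetrovType),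
        g.HasPetrovTypeAt p T) →
      ∀ e ∈ IsManifold.maximalAtlas (𝓡 3) ∞ M, ∀ x ∈ e.target, ∀ k : Fin 3 → ℂ,
        vec e x k ∈ N.line (e.symm x) →
        ∀ c, ∑ a, ∑ b, k a * k b * (cotton (comps g.form e) x a b c
          + 3 * comps g.form e x b c * gradS (comps g.form e) x a) = 0) ∧
    -- Petrov type III, possibly degenerating further
    ((∀ p, ∃ T ∈ ({.typeIII, .typeN, .typeO} : Set PetrovType), g.HasPetrovTypeAt p T) →
      ∀ e ∈ IsManifold.maximalAtlas (𝓡 3) ∞ M, ∀ x ∈ e.target, ∀ k : Fin 3 → ℂ,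
        vec e x k ∈ N.line (e.symm x) →
        (∀ b c, ∑ a, k a * (cotton (comps g.form e) x a b c
          - (comps g.form e x a b * gradS (comps g.form e) x c
              - comps g.form e x a c * gradS (comps g.form e) x b)) = 0) ∧
        (∀ c, ∑ a, ∑ b, k a * k b * cotton (comps g.form e) x a b c = 0) ∧
        ∑ a, k a * gradS (comps g.form e) x a = 0) ∧
    -- Petrov type N, possibly degenerating further
    ((∀ p, ∃ T ∈ ({.typeN, .typeO} : Set PetrovType), g.HasPetrovTypeAt p T) →
      ∀ e ∈ IsManifold.maximalAtlas (𝓡 3) ∞ M, ∀ x ∈ e.target, ∀ k : Fin 3 → ℂ,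
        vec e x k ∈ N.line (e.symm x) →
        (∀ a b, ∑ c, k c * (cotton (comps g.form e) x a b c
          - comps g.form e x c a * gradS (comps g.form e) x b) = 0) ∧
        (∀ b c, ∑ a, k a * cotton (comps g.form e) x a b c = 0) ∧
        ∀ a b, (1 / 2) * (lower (comps g.form e x) k a * gradS (comps g.form e) x b
          - lower (comps g.form e x) k b * gradS (comps g.form e) x a) = 0) := by
  refine ⟨fun _ e he x hx k hk c => ?_, fun hT e he x hx k hk => ?_, fun hT e he x hx k hk => ?_⟩
  all_goals
    obtain ⟨V, i, K, hxV, hVe, hg, hK, hline⟩ := N.exists_isCoGeodeticCovector hgeo he hx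
    -- All claims are homogeneous in k, so the multiple t of the normalised generator only
    -- contributes a factor t or t².
    obtain ⟨t, rfl⟩ := exists_smul_of_vec_mem_line he hx (hline x hxV) hk
    simp only [Pi.smul_apply, smul_eq_mul]
  · have hμ : ContDiffAt ℝ ∞ (fun y =>
        (tracefreeRicci (comps g.form e) y * (comps g.form e y)⁻¹ * K y) i 0) x :=
      (((hg.smooth_tracefreeRicci hxV).mul (hg.smooth_inv hxV)).mul (hK.smooth x hxV)) i 0
    have h := hK.cotton_contract_of_eigen hg hxV hμ
      (fun y hy => tracefreeRicci_eigen he hVe hg hK hline hmult hy) c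
    rw [← mul_zero (t * t), ← h]
    simp only [Finset.mul_sum]
    exact Finset.sum_congr rfl fun a _ => Finset.sum_congr rfl fun b _ => by ring
  · have hker (y) (hy : y ∈ V) := (hT (e.symm y)).elim fun T hT =>
      tracefreeRicci_kernel he hVe hg hline hmult hy hT.1 hT.2
    have hker' := fun y hy => (hker y hy).1
    refine ⟨fun b c => ?_, fun c => ?_, ?_⟩
    · rw [← mul_zero t, ← hK.cotton_single_of_kernel hg hxV hker' (hker x hxV).2 b c]
      simp only [Finset.mul_sum, mul_assoc]
    · rw [← mul_zero (t * t), ← hK.cotton_contract_of_kernel hg hxV hker' c]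
      simp only [Finset.mul_sum]
      exact Finset.sum_congr rfl fun a _ => Finset.sum_congr rfl fun b _ => by ring
    · rw [← mul_zero t, ← hK.gradS_of_kernel hg hxV hker']
      simp only [Finset.mul_sum, mul_assoc]
  · have hker (y) (hy : y ∈ V) := (hT (e.symm y)).elim fun T hT =>
      tracefreeRicci_kernel he hVe hg hline hmult hy (Set.mem_insert_of_mem _ hT.1) hT.2
    have hsq (y) (hy : y ∈ V) := (hT (e.symm y)).elim fun T hT =>
      tracefreeRicci_square he hVe hg hK hline hmult hy hT.1 hT.2
    have hφ := hg.smooth_tracefreeRicci hxV i i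
    obtain ⟨s, hs, -⟩ := hK.exists_gradS_of_square hg hxV hφ hsq
    have hlow (a : Fin 3) : lower (comps g.form e x)
        (t • fun b => ((comps g.form e x)⁻¹ * K x) b 0) a = t * K x a 0 := by
      have h : (comps g.form e x * ((comps g.form e x)⁻¹ * K x)) a 0 = K x a 0 := by
        rw [← Matrix.mul_assoc, hg.mul_inv hxV, Matrix.one_mul]
      rw [← h, Matrix.mul_apply, Finset.mul_sum]
      exact Finset.sum_congr rfl fun b _ => mul_left_comm _ _ _
    refine ⟨fun a b => ?_, fun b c => ?_, fun a b => ?_⟩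
    · rw [← mul_zero t, ← hK.cotton_last_of_square hg hxV hφ hsq a b]
      simp only [Finset.mul_sum, mul_assoc]
    · have h := hK.cotton_single_of_kernel hg hxV (fun y hy => (hker y hy).1) (hker x hxV).2 b c
      have h1 (c : Fin 3) :
          ∑ a, ((comps g.form e x)⁻¹ * K x) a 0 * comps g.form e x a c = K x c 0 := by
        have h : (comps g.form e x * ((comps g.form e x)⁻¹ * K x)) c 0 = K x c 0 := by
          rw [← Matrix.mul_assoc, hg.mul_inv hxV, Matrix.one_mul]
        rw [← h, Matrix.mul_apply]
        exact Finset.sum_congr rfl fun a _ => by rw [hg.apply_symm hxV a c, mul_comm]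
      have hb := h1 b
      have hc := h1 c
      simp only [hs, Fin.sum_univ_three] at h hb hc ⊢
      -- With ∇S = sK the gradient terms of the type III identity are s(K_bK_c − K_cK_b) = 0.
      linear_combination t * h + t * s * K x c 0 * hb - t * s * K x b 0 * hc
    · rw [hlow, hlow, hs, hs]
      ring
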